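/- Let $\sigma_1,\sigma_2,\sigma_3$ be the left-invariant one-forms on $SU(2)$ with $d\sigma_1+\sigma_2\wedge\sigma_3=0$ and cyclically. Let $I\subseteq\mathbb{R}$ be an open interval, and let $M=I\times SU(2)$, with either of its two orientations, carry an LRS Bianchi IX Riemannian metric $$g=a(r)\,dr^2+b(r)\,(\sigma_1^2+\sigma_2^2)+c(r)\,\sigma_3^2,$$ where $a,b,c:I\to(0,\infty)$ are smooth. Suppose that $g$ is not flat (its Riemann tensor does not vanish identically), that its scalar curvature is zero and that its Weyl tensor is anti-self-dual with respect to the chosen orientation. Suppose further that $(M,g)$ admits a radial isometric embedding into $\mathbb{R}^7=\mathbb{R}^4\oplus\mathbb{R}^3$, that is, that there are smooth functions $R,Z:I\to\mathbb{R}$ such that $$\iota(r,q)=\big(R(r)\,q,\;Z(r)\,\pi(q)\big),\qquad q\in SU(2)=S^3\subset\mathbb{R}^4,$$ satisfies $\iota^*\eta=g$. Here $\eta$ is the Euclidean metric and $\pi:S^3\to S^2\subset\mathbb{R}^3$ is the Hopf map $\pi(q)=q\,k\,\bar q$ in terms of unit quaternions; it pulls back the round metric of the unit sphere $S^2$ to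 $\sigma_1^2+\sigma_2^2$, so $\iota^*\eta=g$ says that $$g=dR^2+\tfrac14R^2(\sigma_1^2+\sigma_2^2+\sigma_3^2)+dZ^2+Z^2(\sigma_1^2+\sigma_2^2).$$ (Only $\iota^*\eta=g$ is used; $\iota$ need not be injective.) Then $(M,g)$ is isometric to a constant multiple of the Burns metric: there are a constant $k>0$ and an open interval $J\subseteq(0,\infty)$ such that $(M,g)$ is isometric to the region $\{\rho\in J\}$ of $(0,\infty)\times SU(2)$ with the metric $k\,g_B$, where $$g_B=d\rho^2+\tfrac14\rho^2(\sigma_1^2+\sigma_2^2+\sigma_3^2)+\tfrac14(\sigma_1^2+\sigma_2^2).$$ -/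

import Mathlib

open scoped Quaternion ContDiff

noncomputable section

/-! ### Riemannian geometry on open subsets of a finite-dimensional vector space

A (pseudo-)Riemannian metric is a field of symmetric bilinear forms `g`. All formulas below are the
usual ones in the affine chart given by the vector space itself; `e` is a basis of it,
used only to raise indices and take traces. -/

namespace ChartGeometry

/-- A field of bilinear forms on (an open subset of) the vector space `E`. -/
abbrev MetricField (E : Type*) [NormedAddCommGroup E] [NormedSpace ℝ E] : Type _ :=
  E → LinearMap.BilinForm ℝ E

section Curvature

variable {E : Type*} [NormedAddCommGroup E] [NormedSpace ℝ E]
  {n : Type*} [Fintype n] [DecidableEq n]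

/-- The matrix `g_{ij}` of the metric at `x`. -/
def gram (e : Module.Basis n ℝ E) (g : MetricField E) (x : E) : Matrix n n ℝ :=
  Matrix.of fun i j => g x (e i) (e j)

/-- Christoffel symbols of the first kind,
`(∂_u g(v, w) + ∂_v g(u, w) - ∂_w g(u, v)) / 2`. -/
def christoffelLower (g : MetricField E) (x u v w : E) : ℝ :=
  (fderiv ℝ (fun y => g y v w) x u + fderiv ℝ (fun y => g y u w) x v
    - fderiv ℝ (fun y => g y u v) x w) / 2

/-- Christoffel symbols of the second kind, `Γ(u, v) = u^i v^j Γ^k_{ij} ∂_k`; the Levi-Civita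
connection is `∇_u V = ∂_u V + Γ(u, V)`. -/
def christoffel (e : Module.Basis n ℝ E) (g : MetricField E) (x u v : E) : E :=
  ∑ i, ∑ j, ((gram e g x)⁻¹ i j * christoffelLower g x u v (e j)) • e i

/-- The curvature operator `R(u, v) w = ∇_u ∇_v w - ∇_v ∇_u w` (constant fields `u, v, w`). -/
def curvature (e : Module.Basis n ℝ E) (g : MetricField E) (x u v w : E) : E :=
  fderiv ℝ (fun y => christoffel e g y v w) x u - fderiv ℝ (fun y => christoffel e g y u w) x v
    + christoffel e g x u (christoffel e g x v w) - christoffel e g x v (christoffel e g x u w)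

/-- The Riemann tensor `Rm(u, v, w, z) = g(R(u, v) w, z)`. -/
def riemann (e : Module.Basis n ℝ E) (g : MetricField E) (x u v w z : E) : ℝ :=
  g x (curvature e g x u v w) z

/-- The Ricci tensor `Ric(v, w) = tr (u ↦ R(u, v) w)`. -/
def ricci (e : Module.Basis n ℝ E) (g : MetricField E) (x v w : E) : ℝ :=
  ∑ i, ∑ j, (gram e g x)⁻¹ i j * riemann e g x (e i) v w (e j)

/-- The scalar curvature. -/
def scalarCurvature (e : Module.Basis n ℝ E) (g : MetricField E) (x : E) : ℝ :=
  ∑ i, ∑ j, (gram e g x)⁻¹ i j * ricci e g x (e i) (e j)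

/-- The Weyl tensor of a four-dimensional metric (the coefficients `1/2 = 1/(n-2)` and
`1/6 = 1/((n-1)(n-2))` are those of dimension `n = 4`). -/
def weyl (e : Module.Basis (Fin 4) ℝ E) (g : MetricField E) (x u v w z : E) : ℝ :=
  riemann e g x u v w z
    - (ricci e g x v w * g x u z + g x v w * ricci e g x u z
        - ricci e g x u w * g x v z - g x u w * ricci e g x v z) / 2
    + scalarCurvature e g x / 6 * (g x v w * g x u z - g x u w * g x v z)

/-- The conformal curvature is anti-self-dual on `M`: `⋆W = -W` with respect to the orientation `o`.
For a positively oriented orthonormal frame `f` one has `⋆(f₀ ∧ f₁) = f₂ ∧ f₃`; every pair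
of indices is covered because all positively oriented orthonormal frames are considered. -/
def IsAntiSelfDualOn (e : Module.Basis (Fin 4) ℝ E) (g : MetricField E)
    (o : Orientation ℝ E (Fin 4)) (M : Set E) : Prop :=
  ∀ x ∈ M, ∀ f : Module.Basis (Fin 4) ℝ E, f.orientation = o →
    (∀ i j, g x (f i) (f j) = if i = j then 1 else 0) →
    ∀ w z, weyl e g x (f 2) (f 3) w z = - weyl e g x (f 0) (f 1) w z

/-- The scalar curvature vanishes on `M`. -/
def IsScalarFlatOn (e : Module.Basis n ℝ E) (g : MetricField E) (M : Set E) : Prop :=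
  ∀ x ∈ M, scalarCurvature e g x = 0

/-- The Riemann tensor vanishes identically on `M`. -/
def IsFlatOn (e : Module.Basis n ℝ E) (g : MetricField E) (M : Set E) : Prop :=
  ∀ x ∈ M, ∀ u v w z, riemann e g x u v w z = 0

end Curvature

section Pullback

variable {E F : Type*} [NormedAddCommGroup E] [NormedSpace ℝ E]
  [NormedAddCommGroup F] [NormedSpace ℝ F]

/-- The pull-back `f^* h` of a metric. -/
def pullback (f : E → F) (h : MetricField F) : MetricField E := fun x =>
  (h (f x)).compl₁₂ (fderiv ℝ f x : E →ₗ[ℝ] F) (fderiv ℝ f x : E →ₗ[ℝ] F)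

/-- The flat metric of a Euclidean vector space. -/
def flatMetric (F : Type*) [NormedAddCommGroup F] [InnerProductSpace ℝ F] : MetricField F :=
  fun _ => innerₗ F

/-- The open sets `M` with metric `g` and `N` with metric `h` are isometric: there is a
diffeomorphism `Φ : M → N` with `Φ^* h = g`. -/
def AreIsometric (M : Set E) (g : MetricField E) (N : Set F) (h : MetricField F) : Prop :=
  ∃ Φ : OpenPartialHomeomorph E F, Φ.source = M ∧ Φ.target = N ∧
    ContDiffOn ℝ ∞ Φ M ∧ ContDiffOn ℝ ∞ Φ.symm N ∧ ∀ x ∈ M, pullback Φ h x = g x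

end Pullback

end ChartGeometry

/-! ### Bianchi IX metrics

`SU(2)` is the group of unit quaternions. The nonzero quaternions are identified with
`ℝ × SU(2)` by `x ↦ (log ‖x‖, x / ‖x‖)`, so that left multiplication by unit quaternions is the left
action of `SU(2)`. -/

namespace BianchiIX

open ChartGeometry

/-- The standard basis `1, i, j, k` of the quaternions. -/
def stdBasis : Module.Basis (Fin 4) ℝ ℍ[ℝ] :=
  Module.Basis.ofEquivFun
    (Quaternion.linearIsometryEquivTuple.toLinearEquiv.trans (WithLp.linearEquiv 2 ℝ (Fin 4 → ℝ)))

/-- The coordinate `r` on `ℝ × SU(2)`. -/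
def rCoord (x : ℍ[ℝ]) : ℝ := Real.log ‖x‖

/-- The `SU(2)`-coordinate on `ℝ × SU(2)`. -/
def angular (x : ℍ[ℝ]) : ℍ[ℝ] := ‖x‖⁻¹ • x

/-- The product `I × SU(2)`, as a region in the nonzero quaternions. -/
def region (I : Set ℝ) : Set ℍ[ℝ] := {x | x ≠ 0 ∧ rCoord x ∈ I}

/-- The first of the left-invariant one-forms `σ₁, σ₂, σ₃` on `SU(2)` (pulled back to `ℝ × SU(2)`):
the `i, j, k` components of `2 x⁻¹ dx`. They satisfy `dσ₁ + σ₂ ∧ σ₃ = 0` and cyclically. -/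
def sigma₁ (x : ℍ[ℝ]) : ℍ[ℝ] →ₗ[ℝ] ℝ where
  toFun v := 2 * (x⁻¹ * v).imI
  map_add' v w := by rw [mul_add, Quaternion.imI_add, mul_add]
  map_smul' t v := by
    rw [mul_smul_comm, Quaternion.imI_smul, smul_eq_mul, smul_eq_mul, RingHom.id_apply,
      mul_left_comm]

/-- The second of the left-invariant one-forms. -/
def sigma₂ (x : ℍ[ℝ]) : ℍ[ℝ] →ₗ[ℝ] ℝ where
  toFun v := 2 * (x⁻¹ * v).imJ
  map_add' v w := by rw [mul_add, Quaternion.imJ_add, mul_add]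
  map_smul' t v := by
    rw [mul_smul_comm, Quaternion.imJ_smul, smul_eq_mul, smul_eq_mul, RingHom.id_apply,
      mul_left_comm]

/-- The third of the left-invariant one-forms. -/
def sigma₃ (x : ℍ[ℝ]) : ℍ[ℝ] →ₗ[ℝ] ℝ where
  toFun v := 2 * (x⁻¹ * v).imK
  map_add' v w := by rw [mul_add, Quaternion.imK_add, mul_add]
  map_smul' t v := by
    rw [mul_smul_comm, Quaternion.imK_smul, smul_eq_mul, smul_eq_mul, RingHom.id_apply,
      mul_left_comm]

/-- The differential of a real function as a linear form. -/
def dform (f : ℍ[ℝ] → ℝ) (x : ℍ[ℝ]) : ℍ[ℝ] →ₗ[ℝ] ℝ := (fderiv ℝ f x : ℍ[ℝ] →ₗ[ℝ] ℝ)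

/-- The square `φ²` of a linear form, as a symmetric bilinear form. -/
def sq (φ : ℍ[ℝ] →ₗ[ℝ] ℝ) : LinearMap.BilinForm ℝ ℍ[ℝ] := (LinearMap.mul ℝ ℝ).compl₁₂ φ φ

/-- The metric `a(r) dr² + b(r) (σ₁² + σ₂²) + c(r) σ₃²`. -/
def lrsMetric (a b c : ℝ → ℝ) : MetricField ℍ[ℝ] := fun x =>
  a (rCoord x) • sq (dform rCoord x)
    + b (rCoord x) • (sq (sigma₁ x) + sq (sigma₂ x)) + c (rCoord x) • sq (sigma₃ x)

/-- The Burns metric `dρ² + (ρ²/4) (σ₁² + σ₂² + σ₃²) + (1/4) (σ₁² + σ₂²)` on the nonzero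
quaternions, with `ρ = ‖y‖`. -/
def burnsMetric : MetricField ℍ[ℝ] := fun y =>
  sq (dform (fun x => ‖x‖) y)
    + (‖y‖ ^ 2 / 4) • (sq (sigma₁ y) + sq (sigma₂ y) + sq (sigma₃ y))
    + (1 / 4 : ℝ) • (sq (sigma₁ y) + sq (sigma₂ y))

/-- The imaginary unit `k`. -/
def quatK : ℍ[ℝ] := ⟨0, 0, 0, 1⟩

/-- The Hopf map `q ↦ q k q̄` from `SU(2)` to the unit sphere in the imaginary quaternions. -/
def hopf (q : ℍ[ℝ]) : ℍ[ℝ] := q * quatK * star q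

/-- The radial map `(r, q) ↦ (R(r) q, Z(r) hopf(q))` from `ℝ × SU(2)` to `ℝ⁷ = ℝ⁴ × ℝ³`. -/
def radialMap (R Z : ℝ → ℝ) (x : ℍ[ℝ]) : EuclideanSpace ℝ (Fin 7) :=
  !₂[R (rCoord x) * (angular x).re, R (rCoord x) * (angular x).imI,
    R (rCoord x) * (angular x).imJ, R (rCoord x) * (angular x).imK,
    Z (rCoord x) * (hopf (angular x)).imI, Z (rCoord x) * (hopf (angular x)).imJ,
    Z (rCoord x) * (hopf (angular x)).imK]

end BianchiIX

end

/-! The proof shows that the profile curve `(R, Z)` must be horizontal, that is `Z' = 0`. Then `Z`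
is a constant `Z₀`. If `Z₀ = 0`, the embedding lands in `ℝ⁴` and the metric is flat; otherwise
rescaling `R` by `±1 / (2|Z₀|)` turns the metric into `4 Z₀²` times the Burns metric.

To get `Z' = 0`, the Gauss equation (`riemann_eq_of_pullback`) expresses the curvature through the
second fundamental form, with no intrinsic computation. One point on each `SU(2)`-orbit is enough,
namely the positive real `exp r`, where the three normal components are explicit
(`riemann_radial_real`). Scalar-flatness and the self-dual Weyl component along `f₀ ∧ f₁ + f₂ ∧ f₃`
give two equations (`curvature_equations`) in scale-free quantities: the unit tangent `(c, s)` of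
the profile curve, its curvature `K` multiplied by `R`, and `z = 2Z/R`.

These equations are overdetermined (`profile_horizontal`). Suppose `s ≠ 0`. Eliminating `K` leaves
an algebraic relation between `z` and the half-angle tangent `u`. Differentiating it along the
curve, and substituting for `K` again, gives a second one. In the variables `y = z / u` and `v = u²`
the two polynomials have a nonzero resultant, so `y` takes finitely many values and is locally
constant by continuity; then so is `v`. Hence `K = 0` and `z' = 0`, and the first curvature equation
forces `s = 0` after all. -/

open ChartGeometry Filter Topology

/-! ### The Gauss equation for metrics induced from a Euclidean space. -/

namespace ChartGeometry

section Gauss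

variable {E F : Type*} [NormedAddCommGroup E] [NormedSpace ℝ E]
  [NormedAddCommGroup F] [InnerProductSpace ℝ F]
  {n : Type*} [Fintype n] [DecidableEq n]

theorem pullback_flatMetric_apply (ι : E → F) (x u v : E) :
    pullback ι (flatMetric F) x u v = inner ℝ (fderiv ℝ ι x u) (fderiv ℝ ι x v) := by
  simp [pullback, flatMetric]

theorem differentiableAt_det {A : E → Matrix n n ℝ} {x : E}
    (hA : ∀ i j, DifferentiableAt ℝ (fun y => A y i j) x) :
    DifferentiableAt ℝ (fun y => (A y).det) x := by
  simp only [Matrix.det_apply']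
  refine DifferentiableAt.fun_sum fun σ _ => DifferentiableAt.const_mul ?_ _
  exact (HasFDerivAt.finsetProd fun i _ => (hA (σ i) i).hasFDerivAt).differentiableAt

/-- Cramer's rule reduces this to differentiability of determinants. -/
theorem differentiableAt_matrix_inv {A : E → Matrix n n ℝ} {x : E}
    (hA : ∀ i j, DifferentiableAt ℝ (fun y => A y i j) x) (hdet : (A x).det ≠ 0) (i j : n) :
    DifferentiableAt ℝ (fun y => (A y)⁻¹ i j) x := by
  simp only [Matrix.inv_def, Ring.inverse_eq_inv', Matrix.smul_apply, smul_eq_mul,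
    Matrix.adjugate_apply]
  refine ((differentiableAt_det hA).inv hdet).mul (differentiableAt_det fun k l => ?_)
  by_cases h : k = j
  · subst h; simp [Matrix.updateRow_self]
  · simp only [Matrix.updateRow_ne h]; exact hA k l

variable {ι : E → F} {g : MetricField E} {x : E}

theorem fderiv_metric_of_pullback
    (hι : ContDiffAt ℝ 2 ι x) (hg : ∀ᶠ y in 𝓝 x, g y = pullback ι (flatMetric F) y) (v w : E) :
    HasFDerivAt (fun y => g y v w)
      ((innerSL ℝ (fderiv ℝ ι x v)).comp ((fderiv ℝ (fderiv ℝ ι) x).flip w)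
        + (innerSL ℝ (fderiv ℝ ι x w)).comp ((fderiv ℝ (fderiv ℝ ι) x).flip v)) x := by
  have hD : HasFDerivAt (fderiv ℝ ι) (fderiv ℝ (fderiv ℝ ι) x) x :=
    ((hι.fderiv_right (m := 1) (by norm_num)).differentiableAt (by norm_num)).hasFDerivAt
  have h := (hD.clm_apply (hasFDerivAt_const v x)).inner ℝ (hD.clm_apply (hasFDerivAt_const w x))
  refine (h.congr_fderiv ?_).congr_of_eventuallyEq ?_
  · ext d
    simp [real_inner_comm]
  · filter_upwards [hg] with y hy
    rw [hy, pullback_flatMetric_apply]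

/-- Each derivative of `g` is a sum of two pairings of the Hessian of `ι` with its differential. By
symmetry of the Hessian, four of the six terms cancel and the other two agree. -/
theorem christoffelLower_of_pullback
    (hι : ContDiffAt ℝ 2 ι x) (hg : ∀ᶠ y in 𝓝 x, g y = pullback ι (flatMetric F) y) (u v w : E) :
    christoffelLower g x u v w
      = inner ℝ (fderiv ℝ (fderiv ℝ ι) x u v) (fderiv ℝ ι x w) := by
  have hsymm : IsSymmSndFDerivAt ℝ ι x := hι.isSymmSndFDerivAt (by simp)
  have h := fun b c => fderiv_metric_of_pullback hι hg b c
  rw [christoffelLower, (h v w).fderiv, (h u w).fderiv, (h u v).fderiv]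
  simp only [add_apply, ContinuousLinearMap.comp_apply,
    ContinuousLinearMap.flip_apply, innerSL_apply_apply]
  rw [hsymm.eq w u, hsymm.eq w v, hsymm.eq v u]
  simp only [real_inner_comm]
  rw [real_inner_comm (fderiv ℝ (fderiv ℝ ι) x u v)]
  ring

theorem metric_christoffel (e : Module.Basis n ℝ E) (hdet : (gram e g x).det ≠ 0)
    (hsymm : ∀ u v, g x u v = g x v u) (ℓ : E →ₗ[ℝ] ℝ) (u v : E)
    (hℓ : ∀ w, christoffelLower g x u v w = ℓ w) (w : E) :
    g x (christoffel e g x u v) w = ℓ w := by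
  suffices h : g x (christoffel e g x u v) = ℓ by rw [h]
  refine e.ext fun k => ?_
  have hinv : (gram e g x)⁻¹ * gram e g x = 1 := Matrix.nonsing_inv_mul _ (isUnit_iff_ne_zero.2 hdet)
  have hT : Matrix.transpose (gram e g x)⁻¹ = (gram e g x)⁻¹ := by
    rw [Matrix.transpose_nonsing_inv]
    congr 1
    ext i j
    exact hsymm _ _
  have h1 : ∀ j, ∑ i, (gram e g x)⁻¹ i j * gram e g x i k = if j = k then 1 else 0 := by
    intro j
    have := congrFun (congrFun hinv j) k
    rw [Matrix.mul_apply, Matrix.one_apply] at this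
    rw [← this]
    refine Finset.sum_congr rfl fun i _ => ?_
    rw [← hT, Matrix.transpose_apply, hT]
  simp only [christoffel, map_sum, map_smul, LinearMap.sum_apply, LinearMap.smul_apply, smul_eq_mul,
    hℓ]
  rw [Finset.sum_comm]
  calc ∑ j, ∑ i, (gram e g x)⁻¹ i j * ℓ (e j) * g x (e i) (e k)
      = ∑ j, (∑ i, (gram e g x)⁻¹ i j * gram e g x i k) * ℓ (e j) := by
        refine Finset.sum_congr rfl fun j _ => ?_
        rw [Finset.sum_mul]
        refine Finset.sum_congr rfl fun i _ => ?_
        simp only [gram, Matrix.of_apply]; ring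
    _ = ℓ (e k) := by simp [h1]

/-- The Gauss equation for a metric induced from a Euclidean space: `II` is the second fundamental
form at `x`. -/
theorem riemann_eq_of_pullback (e : Module.Basis n ℝ E)
    (hι : ContDiffAt ℝ 3 ι x) (hg : ∀ᶠ y in 𝓝 x, g y = pullback ι (flatMetric F) y)
    (hdet : (gram e g x).det ≠ 0) (II : E → E → F)
    (hII : ∀ v w, ∃ d, fderiv ℝ (fderiv ℝ ι) x v w = fderiv ℝ ι x d + II v w)
    (hperp : ∀ v w d, inner ℝ (II v w) (fderiv ℝ ι x d) = 0) (u v w z : E) :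
    riemann e g x u v w z = inner ℝ (II v w) (II u z) - inner ℝ (II u w) (II v z) := by
  have hι2 : ∀ᶠ y in 𝓝 x, ContDiffAt ℝ 2 ι y :=
    (hι.of_le (by norm_num)).eventually (by simp)
  have hg2 := hg.eventually_nhds
  have hdiff : ∀ v w, DifferentiableAt ℝ (fun y => g y v w) x := fun v w =>
    (fderiv_metric_of_pullback hι2.self_of_nhds hg v w).differentiableAt
  have hgram : ∀ i j, DifferentiableAt ℝ (fun y => gram e g y i j) x := fun i j => hdiff _ _
  have hdet2 : ∀ᶠ y in 𝓝 x, (gram e g y).det ≠ 0 :=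
    (differentiableAt_det hgram).continuousAt.eventually_ne hdet
  set D := fderiv ℝ ι with hDdef
  have hcD : ContDiffAt ℝ 2 D x := hι.fderiv_right (m := 2) (by norm_num)
  have hD1 : HasFDerivAt D (fderiv ℝ D x) x := (hcD.differentiableAt (by norm_num)).hasFDerivAt
  have hD2 : HasFDerivAt (fderiv ℝ D) (fderiv ℝ (fderiv ℝ D) x) x :=
    ((hcD.fderiv_right (m := 1) (by norm_num)).differentiableAt (by norm_num)).hasFDerivAt
  have hlow : ∀ᶠ y in 𝓝 x, ∀ u v w,
      christoffelLower g y u v w = inner ℝ (fderiv ℝ D y u v) (D y w) := by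
    filter_upwards [hι2, hg2] with y h1 h2 u v w
    exact christoffelLower_of_pullback h1 h2 u v w
  have hchr : ∀ᶠ y in 𝓝 x, ∀ u v w,
      inner ℝ (D y (christoffel e g y u v)) (D y w) = inner ℝ (fderiv ℝ D y u v) (D y w) := by
    filter_upwards [hlow, hdet2, hg] with y h1 h2 h3 u v w
    have := metric_christoffel e h2 (fun a b => by
      rw [h3, pullback_flatMetric_apply, pullback_flatMetric_apply, real_inner_comm])
      ((innerSL ℝ (fderiv ℝ D y u v)).comp (D y) : E →ₗ[ℝ] ℝ) u v (fun w => h1 u v w) w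
    rw [h3, pullback_flatMetric_apply] at this
    exact this
  have hchrx := hchr.self_of_nhds
  have hsym3 : ∀ u v w, fderiv ℝ (fderiv ℝ D) x u v w = fderiv ℝ (fderiv ℝ D) x v u w := by
    intro u v w
    rw [(hcD.isSymmSndFDerivAt (by simp) : IsSymmSndFDerivAt ℝ D x).eq]
  have hsym2 : ∀ u v, fderiv ℝ D x u v = fderiv ℝ D x v u := fun u v =>
    (hι2.self_of_nhds.isSymmSndFDerivAt (by simp) : IsSymmSndFDerivAt ℝ ι x).eq u v
  have hΓ : ∀ v w, DifferentiableAt ℝ (fun y => christoffel e g y v w) x := by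
    intro v w
    unfold christoffel
    refine DifferentiableAt.fun_sum fun i _ => DifferentiableAt.fun_sum fun j _ =>
      DifferentiableAt.smul_const (DifferentiableAt.mul ?_ ?_) _
    · exact differentiableAt_matrix_inv hgram hdet i j
    · have h : (fun y => christoffelLower g y v w (e j)) =ᶠ[𝓝 x]
          fun y => inner ℝ (fderiv ℝ D y v w) (D y (e j)) := by
        filter_upwards [hlow] with y hy using hy _ _ _
      refine DifferentiableAt.congr_of_eventuallyEq ?_ h
      exact (((hD2.clm_apply (hasFDerivAt_const v x)).clm_apply (hasFDerivAt_const w x)).inner ℝ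
        (hD1.clm_apply (hasFDerivAt_const (e j) x))).differentiableAt
  -- the derivative of the equation defining the Christoffel symbols
  have key : ∀ u v w z,
      inner ℝ (D x (fderiv ℝ (fun y => christoffel e g y v w) x u)) (D x z)
        + inner ℝ (D x (christoffel e g x u (christoffel e g x v w))) (D x z)
      = inner ℝ (fderiv ℝ (fderiv ℝ D) x u v w) (D x z)
        + inner ℝ (fderiv ℝ D x v w - D x (christoffel e g x v w)) (fderiv ℝ D x u z) := by
    intro u v w z
    have h1 := (hD1.clm_apply (hΓ v w).hasFDerivAt).inner ℝ
      (hD1.clm_apply (hasFDerivAt_const z x))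
    have h2 := ((hD2.clm_apply (hasFDerivAt_const v x)).clm_apply (hasFDerivAt_const w x)).inner ℝ
        (hD1.clm_apply (hasFDerivAt_const z x))
    have h3 := h2.congr_of_eventuallyEq
      (show (fun y => inner ℝ (D y (christoffel e g y v w)) (D y z)) =ᶠ[𝓝 x] _ by
        filter_upwards [hchr] with y hy using hy v w z)
    have h4 := congrArg (fun T : E →L[ℝ] ℝ => T u) (h1.unique h3)
    simp [inner_add_left] at h4
    rw [hchrx, inner_sub_left]
    linarith
  -- The normal part of the Hessian is unique: by `hchrx`, removing `D (Γ(v, w))` also leaves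
  -- something orthogonal to the tangent space, so the two tangential parts differ by a tangent
  -- vector of norm zero.
  have hII' : ∀ v w, fderiv ℝ D x v w - D x (christoffel e g x v w) = II v w := by
    intro v w
    obtain ⟨d, hd⟩ := hII v w
    have h0 : D x (d - christoffel e g x v w) = 0 := by
      rw [← inner_self_eq_zero (𝕜 := ℝ)]
      have h1 := hchrx v w (d - christoffel e g x v w)
      rw [hd, inner_add_left, hperp, add_zero] at h1
      rw [map_sub] at h1 ⊢
      rw [inner_sub_left, h1, sub_self]
    rw [hd, add_sub_right_comm, ← map_sub, h0, zero_add]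
  have hpair : ∀ v w u z, inner ℝ (II v w) (fderiv ℝ D x u z) = inner ℝ (II v w) (II u z) := by
    intro v w u z
    obtain ⟨d, hd⟩ := hII u z
    rw [hd, inner_add_right, hperp, zero_add]
  rw [riemann, hg.self_of_nhds, pullback_flatMetric_apply, curvature]
  have k1 := key u v w z
  have k2 := key v u w z
  -- Antisymmetrizing `key` in `u, v` cancels the third derivatives of `ι`; only the products of
  -- second fundamental forms survive.
  rw [hII', hpair] at k1 k2
  rw [hsym3 v u w] at k2
  change inner ℝ (D x _) (D x z) = _
  simp only [map_add, map_sub, inner_add_left, inner_sub_left]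
  linarith

end Gauss

end ChartGeometry

/-! ### Elimination: the overdetermined system for the profile curve. -/

namespace BianchiIX

section Elimination

open Polynomial

/-- The relation satisfied by `y = z / u` and `v = u²`, where `z = 2Z/R` and `u` is the tangent of
half the angle between the profile curve and the `R`-axis. -/
def profileRel (y v : ℝ) : ℝ :=
  (4 + 2 * y - 2 * y ^ 2) + (10 * y - 4 * y ^ 2 + 4 * y ^ 3) * v
    + (9 * y ^ 2 - 2 * y ^ 3 - y ^ 4 + y ^ 5) * v ^ 2 + (2 * y ^ 3 + y ^ 4 - y ^ 5) * v ^ 3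

/-- The derivative of `profileRel` along the profile curve, up to a factor. -/
def profileRelDeriv (y v : ℝ) : ℝ :=
  -36 * y + (32 - 136 * y + 16 * y ^ 2 - 32 * y ^ 3) * v
    + (4 * y - 250 * y ^ 2 - 24 * y ^ 3 + 102 * y ^ 4 - 36 * y ^ 5 + 2 * y ^ 6) * v ^ 2
    + (-190 * y ^ 2 - 80 * y ^ 3 - 14 * y ^ 4 - 28 * y ^ 5 + 94 * y ^ 6 - 20 * y ^ 7) * v ^ 3
    + (-280 * y ^ 3 + 56 * y ^ 4 + 80 * y ^ 5 - 80 * y ^ 6 + 16 * y ^ 7 + 24 * y ^ 8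
        - 5 * y ^ 9) * v ^ 4
    + (-132 * y ^ 4 + 72 * y ^ 6 - 8 * y ^ 7 - 28 * y ^ 8 + 10 * y ^ 9) * v ^ 5
    + (-20 * y ^ 5 - 8 * y ^ 6 + 12 * y ^ 7 + 4 * y ^ 8 - 5 * y ^ 9) * v ^ 6

/-- The resultant in `v` is a combination of the two polynomials, so it vanishes at every such `y`;
being a nonzero polynomial in `y`, it has finitely many roots. -/
theorem finite_common_zeros :
    {y : ℝ | ∃ v, profileRel y v = 0 ∧ profileRelDeriv y v = 0}.Finite := by
  let q : ℝ[X][X] := C (4 + 2 * X - 2 * X ^ 2) + C (10 * X - 4 * X ^ 2 + 4 * X ^ 3) * X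
    + C (9 * X ^ 2 - 2 * X ^ 3 - X ^ 4 + X ^ 5) * X ^ 2 + C (2 * X ^ 3 + X ^ 4 - X ^ 5) * X ^ 3
  let t : ℝ[X][X] := C (-36 * X) + C (32 - 136 * X + 16 * X ^ 2 - 32 * X ^ 3) * X
    + C (4 * X - 250 * X ^ 2 - 24 * X ^ 3 + 102 * X ^ 4 - 36 * X ^ 5 + 2 * X ^ 6) * X ^ 2
    + C (-190 * X ^ 2 - 80 * X ^ 3 - 14 * X ^ 4 - 28 * X ^ 5 + 94 * X ^ 6 - 20 * X ^ 7) * X ^ 3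
    + C (-280 * X ^ 3 + 56 * X ^ 4 + 80 * X ^ 5 - 80 * X ^ 6 + 16 * X ^ 7 + 24 * X ^ 8
        - 5 * X ^ 9) * X ^ 4
    + C (-132 * X ^ 4 + 72 * X ^ 6 - 8 * X ^ 7 - 28 * X ^ 8 + 10 * X ^ 9) * X ^ 5
    + C (-20 * X ^ 5 - 8 * X ^ 6 + 12 * X ^ 7 + 4 * X ^ 8 - 5 * X ^ 9) * X ^ 6
  have hq : q.natDegree ≤ 3 := by dsimp only [q]; compute_degree
  have ht : t.natDegree ≤ 6 := by dsimp only [t]; compute_degree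
  obtain ⟨A, B, -, -, hAB⟩ := exists_mul_add_mul_eq_C_resultant q t hq ht (by norm_num)
  have hne : resultant q t 3 6 ≠ 0 := by
    intro h0
    -- The resultant is nonzero because its value at `y = 1` is. There both polynomials keep their
    -- full degrees in `v`, with leading coefficients `2` and `-17`, so coprimality suffices.
    have h1 := resultant_map_map q t 3 6 (evalRingHom (1 : ℝ))
    rw [h0, map_zero] at h1
    have hq1 : q.map (evalRingHom (1 : ℝ))
        = C 4 + C 10 * X + C 7 * X ^ 2 + C 2 * X ^ 3 := by
      dsimp only [q]
      simp only [Polynomial.map_add, Polynomial.map_mul, Polynomial.map_pow, map_C, map_X,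
        coe_evalRingHom]
      simp only [eval_add, eval_sub, eval_mul, eval_pow, eval_X, eval_ofNat]
      norm_num
    have ht1 : t.map (evalRingHom (1 : ℝ))
        = C (-36) + C (-120) * X + C (-202) * X ^ 2 + C (-238) * X ^ 3 + C (-189) * X ^ 4
          + C (-86) * X ^ 5 + C (-17) * X ^ 6 := by
      dsimp only [t]
      simp only [Polynomial.map_add, Polynomial.map_mul, Polynomial.map_pow, map_C, map_X,
        coe_evalRingHom]
      simp only [eval_add, eval_sub, eval_mul, eval_neg, eval_pow, eval_X, eval_ofNat]
      norm_num
    have hqd : (q.map (evalRingHom (1 : ℝ))).natDegree = 3 := by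
      rw [hq1]; compute_degree!
    have htd : (t.map (evalRingHom (1 : ℝ))).natDegree = 6 := by
      rw [ht1]; compute_degree!
    have hcop : IsCoprime (q.map (evalRingHom (1 : ℝ))) (t.map (evalRingHom (1 : ℝ))) := by
      rw [hq1, ht1]
      -- An integral Bézout certificate for the specializations at `y = 1`.
      have h2 : (C (-468358) + C (-907370) * X + C (-1257043) * X ^ 2
          + C (-1184919) * X ^ 3 + C (-616395) * X ^ 4 + C (-138295) * X ^ 5)
            * (C 4 + C 10 * X + C 7 * X ^ 2 + C 2 * X ^ 3)
          + (C (-55129) + C (-47155) * X + C (-16270) * X ^ 2)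
            * (C (-36) + C (-120) * X + C (-202) * X ^ 2 + C (-238) * X ^ 3 + C (-189) * X ^ 4
              + C (-86) * X ^ 5 + C (-17) * X ^ 6) = (C 111212 : ℝ[X]) := by
        simp only [map_neg, map_ofNat]
        ring
      have h3 : ∀ a b f g : ℝ[X], a * f + b * g = C 111212 → IsCoprime f g := fun a b f g h =>
        ⟨C (1 / 111212) * a, C (1 / 111212) * b, by
          rw [mul_assoc, mul_assoc, ← mul_add, h, ← C_mul]; norm_num⟩
      exact h3 _ _ _ _ h2
    have h3 := resultant_ne_zero _ _ hcop
    rw [hqd, htd] at h3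
    exact h3 h1
  refine (rootSet_finite (resultant q t 3 6) ℝ).subset ?_
  rintro y ⟨v, h1, h2⟩
  rw [mem_rootSet]
  refine ⟨hne, ?_⟩
  have h3 := congrArg (fun p => (p.eval (C v)).eval y) hAB
  have hq0 : (q.eval (C v)).eval y = 0 := by
    rw [← h1]
    simp [q, profileRel, eval_add, eval_sub, eval_mul, eval_pow]
  have ht0 : (t.eval (C v)).eval y = 0 := by
    rw [← h2]
    simp [t, profileRelDeriv, eval_add, eval_sub, eval_mul, eval_pow]
  simp only [eval_add, eval_mul, hq0, ht0, zero_mul, add_zero, eval_C] at h3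
  rw [coe_aeval_eq_eval, ← h3]

theorem finite_profileRel_zeros (y : ℝ) : {v : ℝ | profileRel y v = 0}.Finite := by
  let q : ℝ[X] := C (4 + 2 * y - 2 * y ^ 2) + C (10 * y - 4 * y ^ 2 + 4 * y ^ 3) * X
    + C (9 * y ^ 2 - 2 * y ^ 3 - y ^ 4 + y ^ 5) * X ^ 2 + C (2 * y ^ 3 + y ^ 4 - y ^ 5) * X ^ 3
  have hne : q ≠ 0 := by
    intro h
    have h0 : q.coeff 0 = 0 := by rw [h]; simp
    have h1 : q.coeff 1 = 0 := by rw [h]; simp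
    simp [q, coeff_X, coeff_X_pow, -map_add, -map_sub, -map_mul] at h0 h1
    -- The constant coefficient vanishes only at `y = 2` and `y = -1`, where the linear coefficient
    -- is `36` and `-18`.
    have h2 : (y - 2) * (y + 1) = 0 := by linarith
    rcases mul_eq_zero.1 h2 with h3 | h3
    · rw [sub_eq_zero.1 h3] at h1; norm_num at h1
    · rw [eq_neg_of_add_eq_zero_left h3] at h1; norm_num at h1
  refine (rootSet_finite q ℝ).subset fun v hv => ?_
  rw [mem_rootSet]
  refine ⟨hne, ?_⟩
  rw [Set.mem_ofPred_eq] at hv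
  rw [← hv]
  simp [q, profileRel]

end Elimination

/-- Removing the finitely many other values leaves an open neighbourhood of `f x`. -/
theorem eventually_eq_of_finite {α : Type*} [TopologicalSpace α] {f : α → ℝ} {x : α} {S : Set ℝ}
    (hS : S.Finite) (hf : ContinuousAt f x) (h : ∀ᶠ r in 𝓝 x, f r ∈ S) :
    ∀ᶠ r in 𝓝 x, f r = f x := by
  have h1 : (S \ {f x})ᶜ ∈ 𝓝 (f x) :=
    (hS.subset Set.sdiff_subset).isClosed.isOpen_compl.mem_nhds (by simp)
  filter_upwards [h, hf h1] with r hr1 hr2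
  by_contra h3
  exact hr2 ⟨hr1, h3⟩

/-- Both curvature equations are linear in `K`, so `K` can be eliminated between them; the rest is
the rational parametrization of `(c, s)` by the half-angle tangent `u`, with `z = u * y`. -/
theorem profileRel_eq_zero {u y c s K : ℝ} (hu : u ≠ 0) (hc : c * (1 + u ^ 2) = 1 - u ^ 2)
    (hs : s * (1 + u ^ 2) = 2 * u)
    (h1 : K * s * (1 + (u * y) ^ 2) ^ 2 + (s - 2 * (u * y) * c) ^ 2
      - 4 * (u * y) * (u * y * c - 2 * s) = 0)
    (h2 : (1 + (u * y) ^ 2) * (s - 2 * (u * y) * c) * (K + s) = (u * y * c - 2 * s - u * y) ^ 2) :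
    profileRel y (u ^ 2) = 0 := by
  have hh : 1 + u ^ 2 ≠ 0 := by positivity
  have hP : (s - 2 * (u * y) * c) ^ 3 - 4 * (s - 2 * (u * y) * c) * (u * y * c - 2 * s) * (u * y)
      - (s - 2 * (u * y) * c) * s ^ 2 * (1 + (u * y) ^ 2) ^ 2
      + s * (1 + (u * y) ^ 2) * (u * y * c - 2 * s - u * y) ^ 2 = 0 := by
    linear_combination (s - 2 * (u * y) * c) * h1 - s * (1 + (u * y) ^ 2) * h2
  have h3 : 8 * u ^ 3 / (1 + u ^ 2) ^ 3 * profileRel y (u ^ 2) = 0 := by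
    rw [← hP, eq_div_of_mul_eq hh hc, eq_div_of_mul_eq hh hs]
    unfold profileRel
    field_simp
    ring
  have h4 : 8 * u ^ 3 / (1 + u ^ 2) ^ 3 ≠ 0 := by positivity
  exact (mul_eq_zero.1 h3).resolve_left h4

/-- The last hypothesis is the chain rule for `u² * profileRel (z / u) (u²)`, a polynomial in `u`
and `z`. Inserting the evolution equations for `z` and `u`, and `K` from the first curvature
equation, makes it algebraic. -/
theorem profileRelDeriv_eq_zero {u y c s K z' u' l : ℝ} (hu : u ≠ 0) (hl : l ≠ 0)
    (hc : c * (1 + u ^ 2) = 1 - u ^ 2) (hs : s * (1 + u ^ 2) = 2 * u)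
    (h1 : K * s * (1 + (u * y) ^ 2) ^ 2 + (s - 2 * (u * y) * c) ^ 2
      - 4 * (u * y) * (u * y * c - 2 * s) = 0)
    (hz' : z' = -(u * y * c - 2 * s) * l) (hu' : u' = K * l * (1 + u ^ 2) / 2)
    (h : (2 * u + 10 * u ^ 3 + 2 * (-2 - 4 * u ^ 2 + 9 * u ^ 4) * (u * y)
        + 3 * (4 * u - 2 * u ^ 3 + 2 * u ^ 5) * (u * y) ^ 2 + 4 * (u ^ 4 - u ^ 2) * (u * y) ^ 3
        + 5 * (u - u ^ 3) * (u * y) ^ 4) * z'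
      + (8 * u + (2 + 30 * u ^ 2) * (u * y) + (-8 * u + 36 * u ^ 3) * (u * y) ^ 2
        + (4 - 6 * u ^ 2 + 10 * u ^ 4) * (u * y) ^ 3 + (4 * u ^ 3 - 2 * u) * (u * y) ^ 4
        + (1 - 3 * u ^ 2) * (u * y) ^ 5) * u' = 0) :
    profileRelDeriv y (u ^ 2) = 0 := by
  have hh : 1 + u ^ 2 ≠ 0 := by positivity
  have hm : (u * y * c - 2 * s) * (1 + u ^ 2) = u * y * (1 - u ^ 2) - 4 * u := by
    linear_combination u * y * hc - 2 * hs
  have hp : (s - 2 * (u * y) * c) * (1 + u ^ 2) = 2 * u - 2 * (u * y) * (1 - u ^ 2) := by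
    linear_combination hs - 2 * (u * y) * hc
  -- The first curvature equation with denominators cleared, ready to replace `K`.
  have e1 : 2 * u * K * (1 + (u * y) ^ 2) ^ 2 * (1 + u ^ 2) ^ 2
      = 4 * (u * y) * (u * y * (1 - u ^ 2) - 4 * u) * (1 + u ^ 2) ^ 2
        - (2 * u - 2 * (u * y) * (1 - u ^ 2)) ^ 2 * (1 + u ^ 2) := by
    linear_combination (1 + u ^ 2) ^ 3 * h1 - K * (1 + (u * y) ^ 2) ^ 2 * (1 + u ^ 2) ^ 2 * hs
      - (1 + u ^ 2) * ((s - 2 * (u * y) * c) * (1 + u ^ 2)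
        + (2 * u - 2 * (u * y) * (1 - u ^ 2))) * hp + 4 * (u * y) * (1 + u ^ 2) ^ 2 * hm
  set A := (2 * u + 10 * u ^ 3 + 2 * (-2 - 4 * u ^ 2 + 9 * u ^ 4) * (u * y)
        + 3 * (4 * u - 2 * u ^ 3 + 2 * u ^ 5) * (u * y) ^ 2 + 4 * (u ^ 4 - u ^ 2) * (u * y) ^ 3
        + 5 * (u - u ^ 3) * (u * y) ^ 4) with hA
  set B := (8 * u + (2 + 30 * u ^ 2) * (u * y) + (-8 * u + 36 * u ^ 3) * (u * y) ^ 2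
        + (4 - 6 * u ^ 2 + 10 * u ^ 4) * (u * y) ^ 3 + (4 * u ^ 3 - 2 * u) * (u * y) ^ 4
        + (1 - 3 * u ^ 2) * (u * y) ^ 5) with hB
  have h2 : 4 * u ^ 3 * l * profileRelDeriv y (u ^ 2) = 0 := by
    calc 4 * u ^ 3 * l * profileRelDeriv y (u ^ 2)
        = l * (-(4 * u * (1 + (u * y) ^ 2) ^ 2 * A * (u * y * (1 - u ^ 2) - 4 * u))
          + B * (4 * (u * y) * (u * y * (1 - u ^ 2) - 4 * u) * (1 + u ^ 2) ^ 2
            - (2 * u - 2 * (u * y) * (1 - u ^ 2)) ^ 2 * (1 + u ^ 2))) := by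
          rw [hA, hB]; unfold profileRelDeriv; ring
      _ = 0 := by
          rw [← e1]
          rw [hz', hu'] at h
          linear_combination (4 * u * (1 + (u * y) ^ 2) ^ 2 * (1 + u ^ 2)) * h
            + 4 * u * (1 + (u * y) ^ 2) ^ 2 * A * l * hm
  simpa [hu, hl] using h2

/-- Two algebraic relations in two unknowns freeze the direction and the ratio `z / u` wherever `s ≠
0`, and a frozen solution has `s = 0`. The factor `l` is the speed of the parametrization divided by
`R`. -/
theorem profile_horizontal {c s z K l : ℝ → ℝ} {r₀ : ℝ}
    (hcs : ∀ᶠ r in 𝓝 r₀, c r ^ 2 + s r ^ 2 = 1) (hl : ∀ᶠ r in 𝓝 r₀, l r ≠ 0)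
    (hc : ∀ᶠ r in 𝓝 r₀, HasDerivAt c (-(s r * K r * l r)) r)
    (hs : ∀ᶠ r in 𝓝 r₀, HasDerivAt s (c r * K r * l r) r)
    (hz : ∀ᶠ r in 𝓝 r₀, HasDerivAt z (-(z r * c r - 2 * s r) * l r) r)
    (h1 : ∀ᶠ r in 𝓝 r₀, K r * s r * (1 + z r ^ 2) ^ 2 + (s r - 2 * z r * c r) ^ 2
      - 4 * z r * (z r * c r - 2 * s r) = 0)
    (h2 : ∀ᶠ r in 𝓝 r₀, (1 + z r ^ 2) * (s r - 2 * z r * c r) * (K r + s r)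
      = (z r * c r - 2 * s r - z r) ^ 2) :
    s r₀ = 0 := by
  by_contra hs0
  have hsne : ∀ᶠ r in 𝓝 r₀, s r ≠ 0 := hs.self_of_nhds.continuousAt.eventually_ne hs0
  have hcne : ∀ᶠ r in 𝓝 r₀, 1 + c r ≠ 0 := by
    filter_upwards [hsne, hcs] with r h3 h4 h5
    apply h3
    have : c r = -1 := by linarith
    rw [this] at h4
    simpa using h4
  set u : ℝ → ℝ := fun r => s r / (1 + c r) with hu
  set y : ℝ → ℝ := fun r => z r / u r with hy
  have hune : ∀ᶠ r in 𝓝 r₀, u r ≠ 0 := by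
    filter_upwards [hsne, hcne] with r h3 h4 using div_ne_zero h3 h4
  have hzy : ∀ᶠ r in 𝓝 r₀, z r = u r * y r := by
    filter_upwards [hune] with r h3
    simp only [hy]; field_simp
  have hcu : ∀ᶠ r in 𝓝 r₀, c r * (1 + u r ^ 2) = 1 - u r ^ 2 := by
    filter_upwards [hcne, hcs] with r h3 h4
    simp only [hu]; field_simp
    linear_combination (1 + c r) * h4
  have hsu : ∀ᶠ r in 𝓝 r₀, s r * (1 + u r ^ 2) = 2 * u r := by
    filter_upwards [hcne, hcs] with r h3 h4
    simp only [hu]; field_simp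
    linear_combination s r * h4
  have hud : ∀ᶠ r in 𝓝 r₀, HasDerivAt u (K r * l r * (1 + u r ^ 2) / 2) r := by
    filter_upwards [hc, hs, hcne, hcs] with r h3 h4 h5 h6
    refine (h4.div (h3.const_add 1) h5).congr_deriv ?_
    simp only [hu]; field_simp
    linear_combination (K r * l r) * h6
  have hq : ∀ᶠ r in 𝓝 r₀, profileRel (y r) (u r ^ 2) = 0 := by
    filter_upwards [hune, hzy, hcu, hsu, h1, h2] with r a1 a2 a3 a4 a5 a6
    rw [a2] at a5 a6
    exact profileRel_eq_zero a1 a3 a4 a5 a6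
  have ht : ∀ᶠ r in 𝓝 r₀, profileRelDeriv (y r) (u r ^ 2) = 0 := by
    -- Multiplying by `u²` gives a polynomial in `u` and `z`, which can be differentiated without
    -- quotients.
    have hQ : ∀ᶠ r in 𝓝 r₀, 4 * u r ^ 2 + (2 * u r + 10 * u r ^ 3) * z r
        + (-2 - 4 * u r ^ 2 + 9 * u r ^ 4) * z r ^ 2 + (4 * u r - 2 * u r ^ 3 + 2 * u r ^ 5) * z r ^ 3
        + (u r ^ 4 - u r ^ 2) * z r ^ 4 + (u r - u r ^ 3) * z r ^ 5 = 0 := by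
      filter_upwards [hq, hzy] with r a1 a2
      rw [a2]
      unfold profileRel at a1
      linear_combination u r ^ 2 * a1
    filter_upwards [hune, hl, hzy, hcu, hsu, h1, hz, hud, hQ.eventually_nhds]
      with r a1 a0 a2 a3 a4 a5 a6 a7 a8
    have hconst := (hasDerivAt_const r (0 : ℝ)).congr_of_eventuallyEq a8
    have hd := ((((((a7.pow 2).const_mul 4).add (((a7.const_mul 2).add
      ((a7.pow 3).const_mul 10)).mul a6)).add (((((a7.pow 2).const_mul 4).const_sub (-2)).add
      ((a7.pow 4).const_mul 9)).mul (a6.pow 2))).add ((((a7.const_mul 4).sub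
      ((a7.pow 3).const_mul 2)).add ((a7.pow 5).const_mul 2)).mul (a6.pow 3))).add
      (((a7.pow 4).sub (a7.pow 2)).mul (a6.pow 4))).add ((a7.sub (a7.pow 3)).mul (a6.pow 5))
    have he := hd.unique hconst
    simp only [Pi.add_apply, Pi.sub_apply, Pi.pow_apply] at he
    rw [a2] at a5 he
    refine profileRelDeriv_eq_zero a1 a0 a3 a4 a5 rfl rfl ?_
    linear_combination he
  have hyc : ContinuousAt y r₀ :=
    hz.self_of_nhds.continuousAt.div hud.self_of_nhds.continuousAt hune.self_of_nhds
  have hyconst : ∀ᶠ r in 𝓝 r₀, y r = y r₀ := eventually_eq_of_finite finite_common_zeros hyc (by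
    filter_upwards [hq, ht] with r a1 a2 using ⟨_, a1, a2⟩)
  have huconst : ∀ᶠ r in 𝓝 r₀, u r ^ 2 = u r₀ ^ 2 :=
    eventually_eq_of_finite (f := fun r => u r ^ 2) (finite_profileRel_zeros (y r₀))
      (hud.self_of_nhds.continuousAt.pow 2) (by
        filter_upwards [hq, hyconst] with r a1 a2
        rw [← a2]; exact a1)
  have hu0 := hune.self_of_nhds
  have hl0 := hl.self_of_nhds
  have hK : K r₀ = 0 := by
    have h3 := (hud.self_of_nhds.pow 2).unique
      ((hasDerivAt_const r₀ (u r₀ ^ 2)).congr_of_eventuallyEq huconst)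
    have h4 : 1 + u r₀ ^ 2 ≠ 0 := by positivity
    simpa [hu0, hl0, h4] using h3
  have hu' : HasDerivAt u 0 r₀ := by
    have := hud.self_of_nhds
    rw [hK] at this
    simpa using this
  have hm : z r₀ * c r₀ - 2 * s r₀ = 0 := by
    have h3 : HasDerivAt z (0 * y r₀) r₀ := by
      refine (hu'.mul_const (y r₀)).congr_of_eventuallyEq ?_
      filter_upwards [hzy, hyconst] with r a1 a2
      rw [a1, a2]
    have h4 := hz.self_of_nhds.unique h3
    have h5 : (z r₀ * c r₀ - 2 * s r₀) * l r₀ = 0 := by linarith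
    exact (mul_eq_zero.1 h5).resolve_right hl0
  -- With `K = 0` and `z c = 2 s`, the first equation reads `(s - 2 z c)² = 0`, that is `s = 4 s`.
  have h3 := h1.self_of_nhds
  rw [hK, hm] at h3
  have h4 : s r₀ - 2 * z r₀ * c r₀ = 0 := by simpa using h3
  apply hs0
  linarith

end BianchiIX

/-! ### First and second derivatives of the radial map. -/

namespace BianchiIX

theorem quaternion_inner_eq (x y : ℍ[ℝ]) :
    inner ℝ x y = x.re * y.re + x.imI * y.imI + x.imJ * y.imJ + x.imK * y.imK := by
  rw [Quaternion.inner_def]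
  simp

theorem exp_rCoord {x : ℍ[ℝ]} (hx : x ≠ 0) : Real.exp (rCoord x) = ‖x‖ :=
  Real.exp_log (norm_pos_iff.2 hx)

theorem hasFDerivAt_rCoord {x : ℍ[ℝ]} (hx : x ≠ 0) :
    HasFDerivAt rCoord (Real.exp (-2 * rCoord x) • innerSL ℝ x) x := by
  have h : ∀ y : ℍ[ℝ], rCoord y = 1 / 2 * Real.log (‖y‖ ^ 2) := fun y => by
    rw [Real.log_pow, rCoord]; push_cast; ring
  have hx' : ‖x‖ ^ 2 ≠ 0 := by positivity
  have h1 := (((hasStrictFDerivAt_norm_sq x).hasFDerivAt.log hx').const_mul (1 / 2))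
  rw [show rCoord = fun y : ℍ[ℝ] => 1 / 2 * Real.log (‖y‖ ^ 2) from funext h]
  refine h1.congr_fderiv ?_
  ext v
  have : Real.exp (-2 * (1 / 2 * Real.log (‖x‖ ^ 2))) = (‖x‖ ^ 2)⁻¹ := by
    rw [show -2 * (1 / 2 * Real.log (‖x‖ ^ 2)) = -Real.log (‖x‖ ^ 2) by ring, Real.exp_neg,
      Real.exp_log (by positivity)]
  simp only [this]
  simp
  ring

theorem hasFDerivAt_radial {p : ℝ → ℝ} {p' : ℝ} {x : ℍ[ℝ]} (hx : x ≠ 0)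
    (hp : HasDerivAt p p' (rCoord x)) :
    HasFDerivAt (fun y => p (rCoord y)) ((p' * Real.exp (-2 * rCoord x)) • innerSL ℝ x) x := by
  refine (hp.comp_hasFDerivAt x (hasFDerivAt_rCoord hx)).congr_fderiv ?_
  rw [smul_smul]

theorem isOpen_region {I : Set ℝ} (hI : IsOpen I) : IsOpen (region I) := by
  have : ContinuousOn rCoord {x : ℍ[ℝ] | x ≠ 0} := fun x hx =>
    (hasFDerivAt_rCoord hx).continuousAt.continuousWithinAt
  exact this.isOpen_inter_preimage isOpen_ne hI

/-- The inclusion of the quaternions into the first summand of `ℝ⁷ = ℝ⁴ ⊕ ℝ³`. -/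
noncomputable def quatEmb : ℍ[ℝ] →L[ℝ] EuclideanSpace ℝ (Fin 7) :=
  LinearMap.toContinuousLinearMap
    { toFun := fun x => !₂[x.re, x.imI, x.imJ, x.imK, 0, 0, 0]
      map_add' := fun x y => by ext i; fin_cases i <;> simp
      map_smul' := fun t x => by ext i; fin_cases i <;> simp }

/-- The symmetric bilinear map with `hopfForm x x = x k x̄`, with values in the second summand of
`ℝ⁷ = ℝ⁴ ⊕ ℝ³`. -/
noncomputable def hopfForm : ℍ[ℝ] →L[ℝ] ℍ[ℝ] →L[ℝ] EuclideanSpace ℝ (Fin 7) :=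
  LinearMap.toContinuousBilinearMap (LinearMap.mk₂ ℝ (fun x y =>
      !₂[0, 0, 0, 0, x.re * y.imJ + x.imJ * y.re + x.imI * y.imK + x.imK * y.imI,
        x.imJ * y.imK + x.imK * y.imJ - x.re * y.imI - x.imI * y.re,
        x.re * y.re - x.imI * y.imI - x.imJ * y.imJ + x.imK * y.imK])
      (fun x y z => by ext i; fin_cases i <;> simp <;> ring)
      (fun x y z => by ext i; fin_cases i <;> simp <;> ring)
      (fun x y z => by ext i; fin_cases i <;> simp <;> ring)
      (fun x y z => by ext i; fin_cases i <;> simp <;> ring))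

theorem quatEmb_apply (x : ℍ[ℝ]) : quatEmb x = !₂[x.re, x.imI, x.imJ, x.imK, 0, 0, 0] := rfl

theorem hopfForm_apply (x y : ℍ[ℝ]) : hopfForm x y =
    !₂[0, 0, 0, 0, x.re * y.imJ + x.imJ * y.re + x.imI * y.imK + x.imK * y.imI,
        x.imJ * y.imK + x.imK * y.imJ - x.re * y.imI - x.imI * y.re,
        x.re * y.re - x.imI * y.imI - x.imJ * y.imJ + x.imK * y.imK] := rfl

theorem hopfForm_comm (x y : ℍ[ℝ]) : hopfForm x y = hopfForm y x := by
  rw [hopfForm_apply, hopfForm_apply]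
  ext i; fin_cases i <;> simp <;> ring

theorem quatK_re : quatK.re = 0 := rfl
theorem quatK_imI : quatK.imI = 0 := rfl
theorem quatK_imJ : quatK.imJ = 0 := rfl
theorem quatK_imK : quatK.imK = 1 := rfl

/-- Since `x = exp r • q`, the two summands are a linear and a quadratic map of `x` with radial
coefficients, so derivatives come from the product rule. -/
theorem radialMap_eq (R Z : ℝ → ℝ) {x : ℍ[ℝ]} (hx : x ≠ 0) :
    radialMap R Z x = (R (rCoord x) * Real.exp (-rCoord x)) • quatEmb x
      + (Z (rCoord x) * Real.exp (-2 * rCoord x)) • hopfForm x x := by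
  have h1 : Real.exp (-rCoord x) = ‖x‖⁻¹ := by rw [Real.exp_neg, exp_rCoord hx]
  have h2 : Real.exp (-2 * rCoord x) = ‖x‖⁻¹ * ‖x‖⁻¹ := by
    rw [← h1, ← Real.exp_add]; ring_nf
  rw [radialMap, quatEmb_apply, hopfForm_apply, h1, h2]
  ext i; fin_cases i <;> simp [angular, hopf, quatK_re, quatK_imI, quatK_imJ, quatK_imK] <;> ring

section Derivatives

variable {I : Set ℝ} {R R₁ R₂ Z Z₁ Z₂ : ℝ → ℝ} {x : ℍ[ℝ]}

theorem fderiv_radialMap (hx : x ≠ 0) {R' Z' : ℝ} (hR : HasDerivAt R R' (rCoord x))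
    (hZ : HasDerivAt Z Z' (rCoord x)) (w : ℍ[ℝ]) :
    fderiv ℝ (radialMap R Z) x w =
      ((R' - R (rCoord x)) * Real.exp (-3 * rCoord x) * inner ℝ x w) • quatEmb x
      + (R (rCoord x) * Real.exp (-rCoord x)) • quatEmb w
      + ((Z' - 2 * Z (rCoord x)) * Real.exp (-4 * rCoord x) * inner ℝ x w) • hopfForm x x
      + (2 * Z (rCoord x) * Real.exp (-2 * rCoord x)) • hopfForm x w := by
  have hp := hasFDerivAt_radial hx
    (hR.mul ((hasDerivAt_neg (rCoord x)).exp))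
  have hq := hasFDerivAt_radial hx
    (hZ.mul (((hasDerivAt_id (rCoord x)).const_mul (-2)).exp))
  have hd := (hp.smul quatEmb.hasFDerivAt).add
    (hq.smul ((hopfForm.hasFDerivAt (x := x)).clm_apply (hasFDerivAt_id x)))
  have he : HasFDerivAt (radialMap R Z) _ x := hd.congr_of_eventuallyEq (by
    filter_upwards [isOpen_ne.mem_nhds hx] with y hy using radialMap_eq R Z hy)
  rw [he.fderiv]
  have e3 : Real.exp (-3 * rCoord x) = Real.exp (-rCoord x) * Real.exp (-2 * rCoord x) := by
    rw [← Real.exp_add]; ring_nf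
  have e4 : Real.exp (-4 * rCoord x) = Real.exp (-2 * rCoord x) * Real.exp (-2 * rCoord x) := by
    rw [← Real.exp_add]; ring_nf
  simp only [add_apply, smul_apply, e3, e4]
  simp [hopfForm_comm w x]
  module

theorem fderiv_fderiv_radialMap (hI : IsOpen I)
    (hR : ∀ r ∈ I, HasDerivAt R (R₁ r) r) (hR₁ : ∀ r ∈ I, HasDerivAt R₁ (R₂ r) r)
    (hZ : ∀ r ∈ I, HasDerivAt Z (Z₁ r) r) (hZ₁ : ∀ r ∈ I, HasDerivAt Z₁ (Z₂ r) r)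
    (hx : x ∈ region I) (hd : DifferentiableAt ℝ (fderiv ℝ (radialMap R Z)) x) (v w : ℍ[ℝ]) :
    fderiv ℝ (fderiv ℝ (radialMap R Z)) x v w =
      ((R₂ (rCoord x) - 4 * R₁ (rCoord x) + 3 * R (rCoord x)) * Real.exp (-5 * rCoord x)
          * inner ℝ x v * inner ℝ x w
        + (R₁ (rCoord x) - R (rCoord x)) * Real.exp (-3 * rCoord x) * inner ℝ v w) • quatEmb x
      + ((R₁ (rCoord x) - R (rCoord x)) * Real.exp (-3 * rCoord x) * inner ℝ x w) • quatEmb v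
      + ((R₁ (rCoord x) - R (rCoord x)) * Real.exp (-3 * rCoord x) * inner ℝ x v) • quatEmb w
      + ((Z₂ (rCoord x) - 6 * Z₁ (rCoord x) + 8 * Z (rCoord x)) * Real.exp (-6 * rCoord x)
          * inner ℝ x v * inner ℝ x w
        + (Z₁ (rCoord x) - 2 * Z (rCoord x)) * Real.exp (-4 * rCoord x) * inner ℝ v w)
          • hopfForm x x
      + (2 * (Z₁ (rCoord x) - 2 * Z (rCoord x)) * Real.exp (-4 * rCoord x) * inner ℝ x w)
          • hopfForm x v
      + (2 * (Z₁ (rCoord x) - 2 * Z (rCoord x)) * Real.exp (-4 * rCoord x) * inner ℝ x v)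
          • hopfForm x w
      + (2 * Z (rCoord x) * Real.exp (-2 * rCoord x)) • hopfForm v w := by
  obtain ⟨hx0, hxI⟩ := hx
  have hexp : ∀ k : ℝ, HasDerivAt (fun r => Real.exp (k * r)) _ (rCoord x) := fun k =>
    ((hasDerivAt_id (rCoord x)).const_mul k).exp
  have h1 := hasFDerivAt_radial hx0 (((hR₁ _ hxI).sub (hR _ hxI)).mul (hexp (-3)))
  have h2 := hasFDerivAt_radial hx0 ((hR _ hxI).mul ((hasDerivAt_neg (rCoord x)).exp))
  have h3 := hasFDerivAt_radial hx0
    (((hZ₁ _ hxI).sub ((hZ _ hxI).const_mul 2)).mul (hexp (-4)))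
  have h4 := hasFDerivAt_radial hx0 (((hZ _ hxI).const_mul 2).mul (hexp (-2)))
  have hw := (hasFDerivAt_id x).inner ℝ (hasFDerivAt_const w x)
  have hH := hopfForm.hasFDerivAt (x := x)
  have hsum := ((((h1.mul hw).smul quatEmb.hasFDerivAt).add
    (h2.smul (hasFDerivAt_const (quatEmb w) x))).add
    ((h3.mul hw).smul (hH.clm_apply (hasFDerivAt_id x)))).add
    (h4.smul (hH.clm_apply (hasFDerivAt_const w x)))
  have he : HasFDerivAt (fun y => fderiv ℝ (radialMap R Z) y w) _ x :=
    hsum.congr_of_eventuallyEq (by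
      filter_upwards [(isOpen_region hI).mem_nhds ⟨hx0, hxI⟩] with y hy using
        fderiv_radialMap hy.1 (hR _ hy.2) (hZ _ hy.2) w)
  have h5 := congrArg (fun T : ℍ[ℝ] →L[ℝ] EuclideanSpace ℝ (Fin 7) => T v)
    ((hd.hasFDerivAt.clm_apply (hasFDerivAt_const w x)).unique he)
  have e3 : Real.exp (-3 * rCoord x) = Real.exp (-rCoord x) * Real.exp (-2 * rCoord x) := by
    rw [← Real.exp_add]; ring_nf
  have e4 : Real.exp (-4 * rCoord x) = Real.exp (-2 * rCoord x) * Real.exp (-2 * rCoord x) := by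
    rw [← Real.exp_add]; ring_nf
  have e5 : Real.exp (-5 * rCoord x)
      = Real.exp (-rCoord x) * Real.exp (-2 * rCoord x) * Real.exp (-2 * rCoord x) := by
    rw [← Real.exp_add, ← Real.exp_add]; ring_nf
  have e6 : Real.exp (-6 * rCoord x)
      = Real.exp (-2 * rCoord x) * Real.exp (-2 * rCoord x) * Real.exp (-2 * rCoord x) := by
    rw [← Real.exp_add, ← Real.exp_add]; ring_nf
  simp [hopfForm_comm v x] at h5
  simp only [neg_mul] at e3 e4 e5 e6 ⊢
  rw [h5, e3, e4, e5, e6]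
  module

end Derivatives

end BianchiIX

/-! ### Scalar curvature and self-dual Weyl curvature in a diagonalizing basis. -/

namespace ChartGeometry

theorem gram_inv_of_scaled_orthonormal {E n : Type*} [NormedAddCommGroup E] [NormedSpace ℝ E]
    [Fintype n] [DecidableEq n] (e : Module.Basis n ℝ E) (g : MetricField E) (x : E) (d : n → ℝ)
    (hd : ∀ i, d i ≠ 0) (hg : ∀ i j, g x (e i) (e j) = if i = j then d i else 0) :
    (gram e g x)⁻¹ = Matrix.diagonal fun i => (d i)⁻¹ := by
  have h : gram e g x = Matrix.diagonal d := by
    ext i j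
    simp [gram, hg, Matrix.diagonal_apply]
  rw [h]
  refine Matrix.inv_eq_right_inv ?_
  rw [Matrix.diagonal_mul_diagonal]
  simp [hd]

theorem scalarCurvature_of_diagonal {E n : Type*} [NormedAddCommGroup E] [NormedSpace ℝ E]
    [Fintype n] [DecidableEq n] (e : Module.Basis n ℝ E) (g : MetricField E) (x : E) (d : n → ℝ)
    (hd : ∀ i, d i ≠ 0) (hg : ∀ i j, g x (e i) (e j) = if i = j then d i else 0) :
    scalarCurvature e g x
      = ∑ i, ∑ k, (d i)⁻¹ * (d k)⁻¹ * riemann e g x (e k) (e i) (e i) (e k) := by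
  rw [scalarCurvature]
  simp only [ricci, gram_inv_of_scaled_orthonormal e g x d hd hg, Matrix.diagonal_apply, ite_mul,
    zero_mul, Finset.sum_ite_eq, Finset.mem_univ, if_true, Finset.mul_sum, mul_assoc]
  refine Finset.sum_congr rfl fun i _ => ?_
  rw [Finset.sum_eq_single i (fun j _ hj => by simp [hj.symm]) (by simp)]
  simp

/-- The part of the anti-self-duality equation that belongs to a diagonalizing basis of a
scalar-flat metric. -/
theorem riemann_add_of_antiSelfDual {E : Type*} [NormedAddCommGroup E] [NormedSpace ℝ E]
    (e : Module.Basis (Fin 4) ℝ E) (g : MetricField E) (o : Orientation ℝ E (Fin 4)) (M : Set E)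
    (hasd : IsAntiSelfDualOn e g o M) (hs : IsScalarFlatOn e g M) {x : E} (hx : x ∈ M)
    (w : Fin 4 → ℝˣ)
    (hg : ∀ i j, g x (e i) (e j) = if i = j then ((w i : ℝ) ^ 2)⁻¹ else 0)
    (ho : (e.unitsSMul w).orientation = o)
    (hRm : ∀ u v v' z (s t : ℝ),
      riemann e g x u (s • v) (t • v') z = s * t * riemann e g x u v v' z)
    (hRm' : ∀ u v v' z (s t : ℝ),
      riemann e g x (s • u) v v' (t • z) = s * t * riemann e g x u v v' z) :
    (w 0 : ℝ) ^ 2 * (w 1 : ℝ) ^ 2 * riemann e g x (e 0) (e 1) (e 0) (e 1)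
      + (w 2 : ℝ) ^ 2 * (w 3 : ℝ) ^ 2 * riemann e g x (e 2) (e 3) (e 2) (e 3)
      + (w 0 : ℝ) * w 1 * w 2 * w 3 * (riemann e g x (e 0) (e 1) (e 2) (e 3)
        + riemann e g x (e 2) (e 3) (e 0) (e 1)) = 0 := by
  have hw : ∀ i, (w i : ℝ) ≠ 0 := fun i => (w i).ne_zero
  have hf : ∀ i, e.unitsSMul w i = (w i : ℝ) • e i := fun i => by
    rw [Module.Basis.unitsSMul_apply]; rfl
  have horth : ∀ i j, g x (e.unitsSMul w i) (e.unitsSMul w j) = if i = j then 1 else 0 := by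
    intro i j
    rw [hf, hf, map_smul, map_smul, LinearMap.smul_apply, hg]
    by_cases h : i = j
    · subst h
      have := hw i
      simp only [if_true, smul_eq_mul]; field_simp
    · simp [h]
  have hric : ∀ v v' (s t : ℝ), ricci e g x (s • v) (t • v') = s * t * ricci e g x v v' := by
    intro v v' s t
    simp only [ricci, hRm, Finset.mul_sum]
    exact Finset.sum_congr rfl fun i _ => Finset.sum_congr rfl fun j _ => by ring
  have hs0 := hs x hx
  have hsum : ∑ i, (w i : ℝ) ^ 2 * ricci e g x (e i) (e i) = 0 := by
    rw [← hs0, scalarCurvature,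
      gram_inv_of_scaled_orthonormal e g x _ (fun i => inv_ne_zero (pow_ne_zero 2 (hw i))) hg]
    simp [Matrix.diagonal_apply]
  have h1 := hasd x hx _ ho horth (e.unitsSMul w 2) (e.unitsSMul w 3)
  have h2 := hasd x hx _ ho horth (e.unitsSMul w 0) (e.unitsSMul w 1)
  simp only [weyl, hs0, horth] at h1 h2
  simp only [hf, hRm, hRm', hric] at h1 h2
  simp at h1 h2
  rw [Fin.sum_univ_four] at hsum
  -- The sum of the two equations evaluates the Weyl tensor on `f₀ ∧ f₁ + f₂ ∧ f₃`. Its Ricci terms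
  -- add up to half the trace of Ricci, which is zero, so only Riemann components remain.
  linear_combination h1 + h2 - hsum / 2

end ChartGeometry

/-! ### Second fundamental form and curvature at the positive real quaternions. -/

namespace BianchiIX

theorem stdBasis_eq (i : Fin 4) : stdBasis i = ⟨if 0 = i then 1 else 0, if 1 = i then 1 else 0,
    if 2 = i then 1 else 0, if 3 = i then 1 else 0⟩ := by
  simp [stdBasis]
  rfl

theorem stdBasis_re (i : Fin 4) : (stdBasis i).re = if 0 = i then 1 else 0 :=
  congrArg QuaternionAlgebra.re (stdBasis_eq i)

theorem stdBasis_imI (i : Fin 4) : (stdBasis i).imI = if 1 = i then 1 else 0 :=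
  congrArg QuaternionAlgebra.imI (stdBasis_eq i)

theorem stdBasis_imJ (i : Fin 4) : (stdBasis i).imJ = if 2 = i then 1 else 0 :=
  congrArg QuaternionAlgebra.imJ (stdBasis_eq i)

theorem stdBasis_imK (i : Fin 4) : (stdBasis i).imK = if 3 = i then 1 else 0 :=
  congrArg QuaternionAlgebra.imK (stdBasis_eq i)

/-! The coefficients of the second fundamental form of a radial embedding along its three normal
directions. -/

/-- The component of the second fundamental form normal to the profile curve. -/
def sffProfile (κ B G : ℝ) (v w : ℍ[ℝ]) : ℝ :=
  κ * v.re * w.re + B * (v.imI * w.imI + v.imJ * w.imJ) + G * v.imK * w.imK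

/-- The component of the second fundamental form paired with the direction `i`. -/
def sffI (M V : ℝ) (v w : ℍ[ℝ]) : ℝ :=
  2 * M * (v.re * w.imI + v.imI * w.re) + 2 * V * (v.imJ * w.imK + v.imK * w.imJ)

/-- The component of the second fundamental form paired with the direction `j`. -/
def sffJ (M V : ℝ) (v w : ℍ[ℝ]) : ℝ :=
  -2 * M * (v.re * w.imJ + v.imJ * w.re) + 2 * V * (v.imI * w.imK + v.imK * w.imI)

theorem contDiffAt_radialMap {I : Set ℝ} (hI : IsOpen I) {R Z : ℝ → ℝ} (hR : ContDiffOn ℝ ∞ R I)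
    (hZ : ContDiffOn ℝ ∞ Z I) {x : ℍ[ℝ]} (hx : x ∈ region I) :
    ContDiffAt ℝ ∞ (radialMap R Z) x := by
  have hr : ContDiffAt ℝ ∞ rCoord x := (contDiffAt_norm ℝ hx.1).log (norm_ne_zero_iff.2 hx.1)
  have hR' : ContDiffAt ℝ ∞ (fun y => R (rCoord y)) x :=
    ContDiffAt.comp x (hR.contDiffAt (hI.mem_nhds hx.2)) hr
  have hZ' : ContDiffAt ℝ ∞ (fun y => Z (rCoord y)) x :=
    ContDiffAt.comp x (hZ.contDiffAt (hI.mem_nhds hx.2)) hr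
  refine ContDiffAt.congr_of_eventuallyEq
    (f := fun y => (R (rCoord y) * Real.exp (-rCoord y)) • quatEmb y
      + (Z (rCoord y) * Real.exp (-2 * rCoord y)) • hopfForm y y) ?_ ?_
  · exact ((hR'.mul hr.neg.exp).smul quatEmb.contDiff.contDiffAt).add
      ((hZ'.mul (contDiffAt_const.mul hr).exp).smul
        (hopfForm.contDiff.contDiffAt.clm_apply contDiffAt_id))
  · filter_upwards [isOpen_ne.mem_nhds hx.1] with y hy using radialMap_eq R Z hy

theorem exists_quaternion (d₀ d₁ d₂ d₃ : ℝ) :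
    ∃ d : ℍ[ℝ], d.re = d₀ ∧ d.imI = d₁ ∧ d.imJ = d₂ ∧ d.imK = d₃ :=
  ⟨⟨d₀, d₁, d₂, d₃⟩, rfl, rfl, rfl, rfl⟩

section RealPoint

variable {I : Set ℝ} {R R₁ R₂ Z Z₁ Z₂ : ℝ → ℝ} {r : ℝ}

theorem rCoord_coe_exp (r : ℝ) : rCoord ((Real.exp r : ℝ) : ℍ[ℝ]) = r := by
  simp [rCoord]

theorem coe_exp_mem_region (hr : r ∈ I) : ((Real.exp r : ℝ) : ℍ[ℝ]) ∈ region I := by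
  refine ⟨?_, by rwa [rCoord_coe_exp]⟩
  rw [← Quaternion.coe_zero, Ne, Quaternion.coe_inj]
  exact (Real.exp_pos r).ne'

theorem fderiv_radialMap_real {R' Z' : ℝ} (hR : HasDerivAt R R' r) (hZ : HasDerivAt Z Z' r)
    (w : ℍ[ℝ]) :
    fderiv ℝ (radialMap R Z) ((Real.exp r : ℝ) : ℍ[ℝ]) w = Real.exp (-r) •
      !₂[R' * w.re, R r * w.imI, R r * w.imJ, R r * w.imK,
        2 * Z r * w.imJ, -2 * Z r * w.imI, Z' * w.re] := by
  have hx := (coe_exp_mem_region (I := Set.univ) (r := r) trivial).1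
  rw [← rCoord_coe_exp r] at hR hZ
  rw [fderiv_radialMap hx hR hZ, rCoord_coe_exp, quatEmb_apply, quatEmb_apply, hopfForm_apply,
    hopfForm_apply, quaternion_inner_eq]
  have e : Real.exp r = (Real.exp (-r))⁻¹ := by rw [Real.exp_neg, inv_inv]
  have e2 : Real.exp (-2 * r) = Real.exp (-r) ^ 2 := by rw [← Real.exp_nat_mul]; push_cast; ring_nf
  have e3 : Real.exp (-3 * r) = Real.exp (-r) ^ 3 := by rw [← Real.exp_nat_mul]; push_cast; ring_nf
  have e4 : Real.exp (-4 * r) = Real.exp (-r) ^ 4 := by rw [← Real.exp_nat_mul]; push_cast; ring_nf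
  have hne : Real.exp (-r) ≠ 0 := (Real.exp_pos _).ne'
  simp only [Quaternion.re_coe, Quaternion.imI_coe, Quaternion.imJ_coe, Quaternion.imK_coe]
  rw [e2, e3, e4, e]
  generalize Real.exp (-r) = E at *
  ext i
  fin_cases i <;> simp <;> field_simp <;> ring

theorem fderiv_fderiv_radialMap_real (hI : IsOpen I)
    (hR : ∀ r ∈ I, HasDerivAt R (R₁ r) r) (hR₁ : ∀ r ∈ I, HasDerivAt R₁ (R₂ r) r)
    (hZ : ∀ r ∈ I, HasDerivAt Z (Z₁ r) r) (hZ₁ : ∀ r ∈ I, HasDerivAt Z₁ (Z₂ r) r)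
    (hR' : ContDiffOn ℝ ∞ R I) (hZ' : ContDiffOn ℝ ∞ Z I) (hr : r ∈ I) (v w : ℍ[ℝ]) :
    fderiv ℝ (fderiv ℝ (radialMap R Z)) ((Real.exp r : ℝ) : ℍ[ℝ]) v w = Real.exp (-r) ^ 2 •
      !₂[(R₂ r - R₁ r) * (v.re * w.re)
          + (R₁ r - R r) * (v.imI * w.imI + v.imJ * w.imJ + v.imK * w.imK),
        (R₁ r - R r) * (v.re * w.imI + v.imI * w.re),
        (R₁ r - R r) * (v.re * w.imJ + v.imJ * w.re),
        (R₁ r - R r) * (v.re * w.imK + v.imK * w.re),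
        2 * (Z₁ r - Z r) * (v.re * w.imJ + v.imJ * w.re)
          + 2 * Z r * (v.imI * w.imK + v.imK * w.imI),
        -2 * (Z₁ r - Z r) * (v.re * w.imI + v.imI * w.re)
          + 2 * Z r * (v.imJ * w.imK + v.imK * w.imJ),
        (Z₂ r - Z₁ r) * (v.re * w.re)
          + (Z₁ r - 4 * Z r) * (v.imI * w.imI + v.imJ * w.imJ) + Z₁ r * (v.imK * w.imK)] := by
  have hx := coe_exp_mem_region hr
  have hd : DifferentiableAt ℝ (fderiv ℝ (radialMap R Z)) ((Real.exp r : ℝ) : ℍ[ℝ]) :=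
    (((contDiffAt_radialMap hI hR' hZ' hx).fderiv_right (m := 1) (by norm_cast)).differentiableAt
      (by norm_num))
  rw [fderiv_fderiv_radialMap hI hR hR₁ hZ hZ₁ hx hd]
  simp only [rCoord_coe_exp, quatEmb_apply, hopfForm_apply, quaternion_inner_eq]
  have e : Real.exp r = (Real.exp (-r))⁻¹ := by rw [Real.exp_neg, inv_inv]
  have e2 : Real.exp (-2 * r) = Real.exp (-r) ^ 2 := by rw [← Real.exp_nat_mul]; push_cast; ring_nf
  have e3 : Real.exp (-3 * r) = Real.exp (-r) ^ 3 := by rw [← Real.exp_nat_mul]; push_cast; ring_nf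
  have e4 : Real.exp (-4 * r) = Real.exp (-r) ^ 4 := by rw [← Real.exp_nat_mul]; push_cast; ring_nf
  have e5 : Real.exp (-5 * r) = Real.exp (-r) ^ 5 := by rw [← Real.exp_nat_mul]; push_cast; ring_nf
  have e6 : Real.exp (-6 * r) = Real.exp (-r) ^ 6 := by rw [← Real.exp_nat_mul]; push_cast; ring_nf
  have hne : Real.exp (-r) ≠ 0 := (Real.exp_pos _).ne'
  simp only [Quaternion.re_coe, Quaternion.imI_coe, Quaternion.imJ_coe, Quaternion.imK_coe]
  rw [e2, e3, e4, e5, e6, e]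
  generalize Real.exp (-r) = E at *
  ext i
  fin_cases i <;> simp <;> field_simp <;> ring

theorem riemann_radial_real {g : MetricField ℍ[ℝ]} (hI : IsOpen I)
    (hR : ∀ r ∈ I, HasDerivAt R (R₁ r) r) (hR₁ : ∀ r ∈ I, HasDerivAt R₁ (R₂ r) r)
    (hZ : ∀ r ∈ I, HasDerivAt Z (Z₁ r) r) (hZ₁ : ∀ r ∈ I, HasDerivAt Z₁ (Z₂ r) r)
    (hR' : ContDiffOn ℝ ∞ R I) (hZ' : ContDiffOn ℝ ∞ Z I) (hr : r ∈ I)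
    (hg : ∀ x ∈ region I, g x = pullback (radialMap R Z) (flatMetric (EuclideanSpace ℝ (Fin 7))) x)
    (hdet : (gram stdBasis g ((Real.exp r : ℝ) : ℍ[ℝ])).det ≠ 0)
    (hR0 : R r ≠ 0) {κ B G M V A D : ℝ} (hA0 : A ≠ 0) (hA : A = R₁ r ^ 2 + Z₁ r ^ 2)
    (hD : D = R r ^ 2 + 4 * Z r ^ 2) (hκ : κ = R₁ r * Z₂ r - Z₁ r * R₂ r)
    (hB : B = R r * Z₁ r - 4 * Z r * R₁ r) (hG : G = R r * Z₁ r)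
    (hM : M = Z r * R₁ r - R r * Z₁ r) (hV : V = Z r * R r) (u v w z : ℍ[ℝ]) :
    riemann stdBasis g ((Real.exp r : ℝ) : ℍ[ℝ]) u v w z = Real.exp (-r) ^ 4 *
      ((sffProfile κ B G v w * sffProfile κ B G u z
          - sffProfile κ B G u w * sffProfile κ B G v z) / A
        + (sffI M V v w * sffI M V u z - sffI M V u w * sffI M V v z) / D
        + (sffJ M V v w * sffJ M V u z - sffJ M V u w * sffJ M V v z) / D) := by
  have hx := coe_exp_mem_region hr
  have hD0 : D ≠ 0 := by rw [hD]; positivity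
  have hE0 : Real.exp (-r) ≠ 0 := (Real.exp_pos _).ne'
  rw [riemann_eq_of_pullback (ι := radialMap R Z) stdBasis
    ((contDiffAt_radialMap hI hR' hZ' hx).of_le (by norm_cast))
    (by filter_upwards [(isOpen_region hI).mem_nhds hx] with y hy using hg y hy) hdet
    -- The normal space is spanned by the orthogonal vectors `(-Z₁,0,0,0,0,0,R₁)`,
    -- `(0,2Z,0,0,0,R,0)` and `(0,0,-2Z,0,R,0,0)`, of squared lengths `A`, `D`, `D`.
    (fun v w => Real.exp (-r) ^ 2 • !₂[-Z₁ r * (sffProfile κ B G v w / A),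
      2 * Z r * (sffI M V v w / D), -2 * Z r * (sffJ M V v w / D), 0,
      R r * (sffJ M V v w / D), R r * (sffI M V v w / D), R₁ r * (sffProfile κ B G v w / A)])]
  · simp only [PiLp.inner_apply, Fin.sum_univ_succ]
    simp
    generalize sffProfile κ B G v w = p1, sffProfile κ B G u z = p2, sffProfile κ B G u w = p3,
      sffProfile κ B G v z = p4, sffI M V v w = q1, sffI M V u z = q2, sffI M V u w = q3,
      sffI M V v z = q4, sffJ M V v w = s1, sffJ M V u z = s2, sffJ M V u w = s3,
      sffJ M V v z = s4
    field_simp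
    rw [hA, hD]
    ring
  · intro v w
    -- The coordinates of `d` are those of the tangential projection: pairings of the Hessian with
    -- the four orthogonal tangent vectors, divided by their squared lengths `A`, `D`, `D`, `R²`.
    obtain ⟨d, hd0, hd1, hd2, hd3⟩ := exists_quaternion ((R₁ r * ((R₂ r - R₁ r) * (v.re * w.re)
          + (R₁ r - R r) * (v.imI * w.imI + v.imJ * w.imJ + v.imK * w.imK))
        + Z₁ r * ((Z₂ r - Z₁ r) * (v.re * w.re)
          + (Z₁ r - 4 * Z r) * (v.imI * w.imI + v.imJ * w.imJ) + Z₁ r * (v.imK * w.imK))) / A)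
      ((R r * ((R₁ r - R r) * (v.re * w.imI + v.imI * w.re))
        - 2 * Z r * (-2 * (Z₁ r - Z r) * (v.re * w.imI + v.imI * w.re)
          + 2 * Z r * (v.imJ * w.imK + v.imK * w.imJ))) / D)
      ((R r * ((R₁ r - R r) * (v.re * w.imJ + v.imJ * w.re))
        + 2 * Z r * (2 * (Z₁ r - Z r) * (v.re * w.imJ + v.imJ * w.re)
          + 2 * Z r * (v.imI * w.imK + v.imK * w.imI))) / D)
      ((R₁ r - R r) * (v.re * w.imK + v.imK * w.re) / R r)
    refine ⟨Real.exp (-r) • d, ?_⟩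
    rw [fderiv_fderiv_radialMap_real hI hR hR₁ hZ hZ₁ hR' hZ' hr, map_smul,
      fderiv_radialMap_real (hR r hr) (hZ r hr), smul_smul, ← pow_two, ← smul_add]
    congr 1
    ext i
    unfold sffProfile sffI sffJ
    rw [hκ, hB, hG, hM, hV]
    fin_cases i <;> simp [hd0, hd1, hd2, hd3] <;> field_simp <;> (try rw [hA]) <;> (try rw [hD]) <;> ring
  · intro v w d
    rw [fderiv_radialMap_real (hR r hr) (hZ r hr)]
    simp only [PiLp.inner_apply, Fin.sum_univ_succ]
    simp
    ring

end RealPoint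

end BianchiIX

/-! ### Nondegeneracy of the metric and the two curvature equations. -/

namespace ChartGeometry

theorem gram_det_ne_zero {E n : Type*} [NormedAddCommGroup E] [NormedSpace ℝ E]
    [Fintype n] [DecidableEq n] (e : Module.Basis n ℝ E) (g : MetricField E) (x : E)
    (h : ∀ v, g x v v = 0 → v = 0) : (gram e g x).det ≠ 0 := by
  intro hdet
  obtain ⟨c, hc0, hc⟩ := Matrix.exists_mulVec_eq_zero_iff.2 hdet
  apply hc0
  have hv : ∀ i, g x (e i) (∑ j, c j • e j) = 0 := fun i => by
    have := congrFun hc i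
    simp only [Matrix.mulVec, dotProduct, gram, Matrix.of_apply, Pi.zero_apply] at this
    rw [map_sum, ← this]
    exact Finset.sum_congr rfl fun j _ => by rw [map_smul, smul_eq_mul, mul_comm]
  have h0 : ∑ j, c j • e j = 0 := h _ (by
    conv_lhs => enter [1]; rw [map_sum]
    rw [LinearMap.sum_apply]
    refine Finset.sum_eq_zero fun j _ => ?_
    rw [map_smul, LinearMap.smul_apply, hv, smul_zero])
  have := e.linearIndependent
  rw [Fintype.linearIndependent_iff] at this
  exact funext (this c h0)

end ChartGeometry

namespace BianchiIX

theorem dform_rCoord {x : ℍ[ℝ]} (hx : x ≠ 0) (v : ℍ[ℝ]) :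
    dform rCoord x v = Real.exp (-2 * rCoord x) * inner ℝ x v := by
  simp [dform, (hasFDerivAt_rCoord hx).fderiv]

theorem lrsMetric_apply (a b c : ℝ → ℝ) (x u v : ℍ[ℝ]) :
    lrsMetric a b c x u v = a (rCoord x) * (dform rCoord x u * dform rCoord x v)
      + b (rCoord x) * (sigma₁ x u * sigma₁ x v + sigma₂ x u * sigma₂ x v)
      + c (rCoord x) * (sigma₃ x u * sigma₃ x v) := rfl

/-- If all `σᵢ` vanish on `v`, then `x⁻¹ v` is real and `v` is radial; `dr` detects radial vectors.
-/
theorem lrsMetric_definite {a b c : ℝ → ℝ} {x v : ℍ[ℝ]} (hx : x ≠ 0) (ha : 0 < a (rCoord x))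
    (hb : 0 < b (rCoord x)) (hc : 0 < c (rCoord x)) (h : lrsMetric a b c x v v = 0) : v = 0 := by
  rw [lrsMetric_apply] at h
  have h0 := mul_nonneg ha.le (mul_self_nonneg (dform rCoord x v))
  have h1 := mul_nonneg hb.le (mul_self_nonneg (sigma₁ x v))
  have h2 := mul_nonneg hb.le (mul_self_nonneg (sigma₂ x v))
  have h3 := mul_nonneg hc.le (mul_self_nonneg (sigma₃ x v))
  rw [mul_add] at h
  have e0 : dform rCoord x v = 0 := by
    have : a (rCoord x) * (dform rCoord x v * dform rCoord x v) = 0 := by linarith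
    simpa [ha.ne'] using this
  have e1 : sigma₁ x v = 0 := by
    have : b (rCoord x) * (sigma₁ x v * sigma₁ x v) = 0 := by linarith
    simpa [hb.ne'] using this
  have e2 : sigma₂ x v = 0 := by
    have : b (rCoord x) * (sigma₂ x v * sigma₂ x v) = 0 := by linarith
    simpa [hb.ne'] using this
  have e3 : sigma₃ x v = 0 := by
    have : c (rCoord x) * (sigma₃ x v * sigma₃ x v) = 0 := by linarith
    simpa [hc.ne'] using this
  change 2 * (x⁻¹ * v).imI = 0 at e1
  change 2 * (x⁻¹ * v).imJ = 0 at e2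
  change 2 * (x⁻¹ * v).imK = 0 at e3
  have hq : x⁻¹ * v = ((x⁻¹ * v).re : ℍ[ℝ]) := by
    ext
    · exact (Quaternion.re_coe _).symm
    · rw [Quaternion.imI_coe]; linarith
    · rw [Quaternion.imJ_coe]; linarith
    · rw [Quaternion.imK_coe]; linarith
  have hv : v = (x⁻¹ * v).re • x := by
    rw [← Quaternion.mul_coe_eq_smul, ← hq, mul_inv_cancel_left₀ hx]
  rw [dform_rCoord hx, hv, inner_smul_right, real_inner_self_eq_norm_sq] at e0
  have hn : ‖x‖ ≠ 0 := norm_ne_zero_iff.2 hx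
  have h4 : (x⁻¹ * v).re = 0 := by
    simpa [Real.exp_ne_zero, hn] using e0
  rw [hv, h4, zero_smul]

theorem lrsMetric_real (a b c : ℝ → ℝ) (r : ℝ) (u v : ℍ[ℝ]) :
    lrsMetric a b c ((Real.exp r : ℝ) : ℍ[ℝ]) u v = Real.exp (-r) ^ 2 * (a r * (u.re * v.re)
      + 4 * b r * (u.imI * v.imI + u.imJ * v.imJ) + 4 * c r * (u.imK * v.imK)) := by
  have hx := (coe_exp_mem_region (I := Set.univ) (r := r) trivial).1
  have e : Real.exp (-2 * r) * Real.exp r = Real.exp (-r) := by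
    rw [← Real.exp_add]; ring_nf
  have hinv : ((Real.exp r : ℝ) : ℍ[ℝ])⁻¹ = ((Real.exp (-r) : ℝ) : ℍ[ℝ]) := by
    rw [Real.exp_neg, Quaternion.coe_inv]
  have hd : ∀ v, dform rCoord ((Real.exp r : ℝ) : ℍ[ℝ]) v = Real.exp (-r) * v.re := fun v => by
    rw [dform_rCoord hx, rCoord_coe_exp, quaternion_inner_eq, ← e]
    simp [mul_assoc]
  have h1 : ∀ v, sigma₁ ((Real.exp r : ℝ) : ℍ[ℝ]) v = 2 * Real.exp (-r) * v.imI := fun v => by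
    change 2 * (_ * v).imI = _
    rw [hinv]; simp [mul_assoc]
  have h2 : ∀ v, sigma₂ ((Real.exp r : ℝ) : ℍ[ℝ]) v = 2 * Real.exp (-r) * v.imJ := fun v => by
    change 2 * (_ * v).imJ = _
    rw [hinv]; simp [mul_assoc]
  have h3 : ∀ v, sigma₃ ((Real.exp r : ℝ) : ℍ[ℝ]) v = 2 * Real.exp (-r) * v.imK := fun v => by
    change 2 * (_ * v).imK = _
    rw [hinv]; simp [mul_assoc]
  rw [lrsMetric_apply, rCoord_coe_exp, hd, hd, h1, h1, h2, h2, h3, h3]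
  ring

section RealPoint

variable {I : Set ℝ} {a b c R R₁ R₂ Z Z₁ Z₂ : ℝ → ℝ} {r : ℝ}

theorem pullback_radialMap_real {R' Z' : ℝ} (hR : HasDerivAt R R' r) (hZ : HasDerivAt Z Z' r)
    (u v : ℍ[ℝ]) :
    pullback (radialMap R Z) (flatMetric (EuclideanSpace ℝ (Fin 7))) ((Real.exp r : ℝ) : ℍ[ℝ]) u v
      = Real.exp (-r) ^ 2 * ((R' ^ 2 + Z' ^ 2) * (u.re * v.re)
        + (R r ^ 2 + 4 * Z r ^ 2) * (u.imI * v.imI + u.imJ * v.imJ)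
        + R r ^ 2 * (u.imK * v.imK)) := by
  rw [pullback_flatMetric_apply, fderiv_radialMap_real hR hZ, fderiv_radialMap_real hR hZ]
  simp only [PiLp.inner_apply, Fin.sum_univ_succ]
  simp
  ring

/-- The equations `b = R²/4 + Z²`, `c = R²/4`, `a = R'² + Z'²`. -/
theorem coefficients_of_isometric {R' Z' : ℝ} (hR : HasDerivAt R R' r) (hZ : HasDerivAt Z Z' r)
    (hg : pullback (radialMap R Z) (flatMetric (EuclideanSpace ℝ (Fin 7))) ((Real.exp r : ℝ) : ℍ[ℝ])
      = lrsMetric a b c ((Real.exp r : ℝ) : ℍ[ℝ])) :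
    a r = R' ^ 2 + Z' ^ 2 ∧ b r = R r ^ 2 / 4 + Z r ^ 2 ∧ c r = R r ^ 2 / 4 := by
  have h : ∀ i, _ := fun i =>
    congrArg (fun T : LinearMap.BilinForm ℝ ℍ[ℝ] => T (stdBasis i) (stdBasis i)) hg
  simp only [pullback_radialMap_real hR hZ, lrsMetric_real, stdBasis_re, stdBasis_imI,
    stdBasis_imJ, stdBasis_imK] at h
  have hE : Real.exp (-r) ≠ 0 := (Real.exp_pos _).ne'
  have h0 := h 0
  have h1 := h 1
  have h3 := h 3
  simp [hE] at h0 h1 h3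
  exact ⟨h0.symm, by linarith, by linarith⟩

/-- Here `(γ, s)` is the unit tangent of the profile curve, `K` its curvature times `R`, and `w` its
speed up to sign. The sign of `w`, fixed by `ho`, makes the chosen frame positively oriented, so
both orientations lead to the same equations. -/
theorem curvature_equations (hI : IsOpen I)
    (hR : ∀ r ∈ I, HasDerivAt R (R₁ r) r) (hR₁ : ∀ r ∈ I, HasDerivAt R₁ (R₂ r) r)
    (hZ : ∀ r ∈ I, HasDerivAt Z (Z₁ r) r) (hZ₁ : ∀ r ∈ I, HasDerivAt Z₁ (Z₂ r) r)
    (hR' : ContDiffOn ℝ ∞ R I) (hZ' : ContDiffOn ℝ ∞ Z I)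
    (ha : ∀ r ∈ I, 0 < a r) (hb : ∀ r ∈ I, 0 < b r) (hc : ∀ r ∈ I, 0 < c r)
    (o : Orientation ℝ ℍ[ℝ] (Fin 4))
    (hasd : IsAntiSelfDualOn stdBasis (lrsMetric a b c) o (region I))
    (hs : IsScalarFlatOn stdBasis (lrsMetric a b c) (region I))
    (hg : ∀ x ∈ region I, pullback (radialMap R Z) (flatMetric (EuclideanSpace ℝ (Fin 7))) x
      = lrsMetric a b c x)
    (hr : r ∈ I) {w : ℝ} (hw : w ^ 2 = R₁ r ^ 2 + Z₁ r ^ 2)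
    (ho : (o = stdBasis.orientation ∧ w * R r < 0) ∨ (o = -stdBasis.orientation ∧ 0 < w * R r))
    {K γ ζ s : ℝ} (hK : K = (R₁ r * Z₂ r - Z₁ r * R₂ r) * R r / w ^ 3)
    (hγ : γ = R₁ r / w) (hσ : s = Z₁ r / w) (hζ : ζ = 2 * Z r / R r) :
    K * s * (1 + ζ ^ 2) ^ 2 + (s - 2 * ζ * γ) ^ 2 - 4 * ζ * (ζ * γ - 2 * s) = 0 ∧
      (1 + ζ ^ 2) * (s - 2 * ζ * γ) * (K + s) = (ζ * γ - 2 * s - ζ) ^ 2 := by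
  have hx := coe_exp_mem_region hr
  have hwR : w * R r ≠ 0 := by rcases ho with ho | ho; exacts [ho.2.ne, ho.2.ne']
  have hw0 : w ≠ 0 := left_ne_zero_of_mul hwR
  have hR0 : R r ≠ 0 := right_ne_zero_of_mul hwR
  have hE0 : Real.exp (-r) ≠ 0 := (Real.exp_pos _).ne'
  set E := Real.exp (-r) with hE
  have hD0 : 0 < R r ^ 2 + 4 * Z r ^ 2 := by positivity
  obtain ⟨D, hD⟩ : ∃ D, D = R r ^ 2 + 4 * Z r ^ 2 := ⟨_, rfl⟩
  have hDpos : 0 < D := hD ▸ hD0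
  have hDne := hDpos.ne'
  have hsD : √D ^ 2 = D := Real.sq_sqrt hDpos.le
  have hsD0 : √D ≠ 0 := (Real.sqrt_pos.2 hDpos).ne'
  have hdet := gram_det_ne_zero stdBasis (lrsMetric a b c) ((Real.exp r : ℝ) : ℍ[ℝ])
    (fun v => lrsMetric_definite hx.1 (ha _ hx.2) (hb _ hx.2) (hc _ hx.2))
  have hRm := riemann_radial_real hI hR hR₁ hZ hZ₁ hR' hZ' hr (fun x hx => (hg x hx).symm) hdet hR0
    (A := w ^ 2) (by positivity) hw hD rfl rfl rfl rfl rfl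
  obtain ⟨κ, hκ⟩ : ∃ κ, κ = R₁ r * Z₂ r - Z₁ r * R₂ r := ⟨_, rfl⟩
  rw [← hκ] at hRm hK
  -- Scaling factors that make the standard basis orthonormal; the signs of `w` and `R` are kept, so
  -- the determinant has the sign of `-(w * R)`.
  let W : Fin 4 → ℝˣ := ![Units.mk0 (-(E * w)⁻¹) (by simp [hE0, hw0]),
    Units.mk0 ((E * √D)⁻¹) (by simp [hE0, hsD0]), Units.mk0 ((E * √D)⁻¹) (by simp [hE0, hsD0]),
    Units.mk0 ((E * R r)⁻¹) (by simp [hE0, hR0])]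
  have hW0 : (W 0 : ℝ) = -(E * w)⁻¹ := rfl
  have hW1 : (W 1 : ℝ) = (E * √D)⁻¹ := rfl
  have hW2 : (W 2 : ℝ) = (E * √D)⁻¹ := rfl
  have hW3 : (W 3 : ℝ) = (E * R r)⁻¹ := rfl
  have hgij : ∀ i j, lrsMetric a b c ((Real.exp r : ℝ) : ℍ[ℝ]) (stdBasis i) (stdBasis j)
      = if i = j then ((W i : ℝ) ^ 2)⁻¹ else 0 := by
    intro i j
    rw [← hg _ hx, pullback_radialMap_real (hR r hr) (hZ r hr), ← hw, ← hD, ← hE]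
    simp only [stdBasis_re, stdBasis_imI, stdBasis_imJ, stdBasis_imK]
    fin_cases i <;> fin_cases j <;> simp [hW0, hW1, hW2, hW3, mul_pow, hsD]
  have hprod : ((∏ i, W i : ℝˣ) : ℝ) = -(E ^ 4 * D)⁻¹ * (w * R r)⁻¹ := by
    rw [Fin.prod_univ_four]
    push_cast
    rw [hW0, hW1, hW2, hW3]
    field_simp
    rw [hsD]
  have hori : (stdBasis.unitsSMul W).orientation = o := by
    rw [Module.Basis.orientation_unitsSMul]
    rcases ho with ⟨ho, h⟩ | ⟨ho, h⟩
    · rw [ho]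
      refine Module.Ray.units_smul_of_pos _ ?_ _
      rw [Units.val_inv_eq_inv_val, hprod, inv_pos, neg_mul, neg_pos]
      exact mul_neg_of_pos_of_neg (by positivity) (inv_lt_zero.2 h)
    · rw [ho]
      refine Module.Ray.units_smul_of_neg _ ?_ _
      rw [Units.val_inv_eq_inv_val, hprod, inv_lt_zero, neg_mul, neg_lt_zero]
      positivity
  have hsmul : ∀ u v v' z (s t : ℝ), riemann stdBasis (lrsMetric a b c) ((Real.exp r : ℝ) : ℍ[ℝ])
      u (s • v) (t • v') z
      = s * t * riemann stdBasis (lrsMetric a b c) ((Real.exp r : ℝ) : ℍ[ℝ]) u v v' z := by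
    intro u v v' z s t
    rw [hRm, hRm]
    simp [sffProfile, sffI, sffJ]
    ring
  have hsmul' : ∀ u v v' z (s t : ℝ), riemann stdBasis (lrsMetric a b c) ((Real.exp r : ℝ) : ℍ[ℝ])
      (s • u) v v' (t • z)
      = s * t * riemann stdBasis (lrsMetric a b c) ((Real.exp r : ℝ) : ℍ[ℝ]) u v v' z := by
    intro u v v' z s t
    rw [hRm, hRm]
    simp [sffProfile, sffI, sffJ]
    ring
  have h1 := riemann_add_of_antiSelfDual stdBasis _ o _ hasd hs hx W hgij hori hsmul hsmul'
  have h2 := scalarCurvature_of_diagonal stdBasis _ _ _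
    (fun i => inv_ne_zero (pow_ne_zero 2 (W i).ne_zero)) hgij
  rw [hs _ hx] at h2
  simp only [Fin.sum_univ_four, hRm, sffProfile, sffI, sffJ, stdBasis_re, stdBasis_imI, stdBasis_imJ,
    stdBasis_imK] at h1 h2
  simp only [hW0, hW1, hW2, hW3] at h1 h2
  simp at h1 h2
  rw [← hE] at h1 h2
  generalize √D = S at h1 h2 hsD hsD0
  subst hsD
  field_simp at h1 h2
  have hN : 1 + ζ ^ 2 = S ^ 2 / R r ^ 2 := by
    rw [hζ, hD]; field_simp; ring
  rw [hN, hK, hγ, hσ, hζ]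
  constructor
  · field_simp
    -- Here `h1` is the self-dual component and `h2` the scalar curvature; the second relation needs
    -- `h1` alone.
    linear_combination 2 * h1 - h2 / 2
  · field_simp
    linear_combination -h1

end RealPoint

end BianchiIX

/-! ### Constancy of `Z`. -/

namespace BianchiIX

variable {I : Set ℝ} {a b c R Z : ℝ → ℝ}

theorem hasDerivAt_of_contDiffOn {f : ℝ → ℝ} (hI : IsOpen I) (hf : ContDiffOn ℝ ∞ f I) {r : ℝ}
    (hr : r ∈ I) : HasDerivAt f (deriv f r) r :=
  ((hf.contDiffAt (hI.mem_nhds hr)).differentiableAt (by norm_num)).hasDerivAt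

theorem contDiffOn_deriv {f : ℝ → ℝ} (hI : IsOpen I) (hf : ContDiffOn ℝ ∞ f I) :
    ContDiffOn ℝ ∞ (deriv f) I :=
  hf.deriv_of_isOpen hI (by norm_cast)

theorem exists_sign_of_ne_zero (hI : IsPreconnected I) (hR : ContinuousOn R I)
    (h0 : ∀ r ∈ I, R r ≠ 0) : ∃ σ : ℝ, (σ = 1 ∨ σ = -1) ∧ ∀ r ∈ I, 0 < σ * R r := by
  by_cases h : ∃ r₀ ∈ I, 0 < R r₀
  · obtain ⟨r₀, hr₀, hpos⟩ := h
    refine ⟨1, Or.inl rfl, fun r hr => ?_⟩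
    rw [one_mul]
    by_contra hneg
    obtain ⟨t, ht, ht0⟩ := hI.intermediate_value hr hr₀ hR ⟨not_lt.1 hneg, hpos.le⟩
    exact h0 t ht ht0
  · push Not at h
    refine ⟨-1, Or.inr rfl, fun r hr => ?_⟩
    have := lt_of_le_of_ne (h r hr) (h0 r hr)
    linarith

theorem deriv_eq_zero_of_antiSelfDual (hI : IsOpen I) (hconn : IsPreconnected I)
    (ha : ∀ r ∈ I, 0 < a r) (hb : ∀ r ∈ I, 0 < b r) (hc : ∀ r ∈ I, 0 < c r)
    (o : Orientation ℝ ℍ[ℝ] (Fin 4))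
    (hasd : IsAntiSelfDualOn stdBasis (lrsMetric a b c) o (region I))
    (hs : IsScalarFlatOn stdBasis (lrsMetric a b c) (region I))
    (hR : ContDiffOn ℝ ∞ R I) (hZ : ContDiffOn ℝ ∞ Z I)
    (hg : ∀ x ∈ region I, pullback (radialMap R Z) (flatMetric (EuclideanSpace ℝ (Fin 7))) x
      = lrsMetric a b c x) {r : ℝ} (hr : r ∈ I) : deriv Z r = 0 := by
  have dR := fun r (hr : r ∈ I) => hasDerivAt_of_contDiffOn hI hR hr
  have dZ := fun r (hr : r ∈ I) => hasDerivAt_of_contDiffOn hI hZ hr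
  have dR₁ := fun r (hr : r ∈ I) => hasDerivAt_of_contDiffOn hI (contDiffOn_deriv hI hR) hr
  have dZ₁ := fun r (hr : r ∈ I) => hasDerivAt_of_contDiffOn hI (contDiffOn_deriv hI hZ) hr
  have hcoef := fun r (hr : r ∈ I) =>
    coefficients_of_isometric (dR r hr) (dZ r hr) (hg _ (coe_exp_mem_region hr))
  have hR0 : ∀ r ∈ I, R r ≠ 0 := fun r hr h0 => by
    have := hc r hr
    rw [(hcoef r hr).2.2, h0] at this
    norm_num at this
  have hApos : ∀ r ∈ I, 0 < deriv R r ^ 2 + deriv Z r ^ 2 := fun r hr => by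
    rw [← (hcoef r hr).1]; exact ha r hr
  obtain ⟨σ, hσ, hσpos⟩ := exists_sign_of_ne_zero hconn hR.continuousOn hR0
  -- Since `R` has constant sign `σ`, one sign `ε` of the speed fits the orientation on all of `I`,
  -- and `w` stays differentiable.
  obtain ⟨ε, hε, hε2⟩ : ∃ ε : ℝ, ε ^ 2 = 1 ∧ ((o = stdBasis.orientation ∧ ε = -σ) ∨
      (o = -stdBasis.orientation ∧ ε = σ)) := by
    have hσ2 : σ ^ 2 = 1 := by rcases hσ with h | h <;> rw [h] <;> norm_num
    rcases stdBasis.orientation_eq_or_eq_neg o with h | h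
    · exact ⟨-σ, by rw [neg_sq, hσ2], Or.inl ⟨h, rfl⟩⟩
    · exact ⟨σ, hσ2, Or.inr ⟨h, rfl⟩⟩
  set w : ℝ → ℝ := fun r => ε * √(deriv R r ^ 2 + deriv Z r ^ 2) with hw
  have hw2 : ∀ r ∈ I, w r ^ 2 = deriv R r ^ 2 + deriv Z r ^ 2 := fun r hr => by
    rw [hw]
    simp only [mul_pow, hε, one_mul]
    exact Real.sq_sqrt (hApos r hr).le
  have hw0 : ∀ r ∈ I, w r ≠ 0 := fun r hr h0 => by
    have := hw2 r hr
    rw [h0] at this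
    have := hApos r hr
    linarith
  have ho : ∀ r ∈ I, (o = stdBasis.orientation ∧ w r * R r < 0) ∨
      (o = -stdBasis.orientation ∧ 0 < w r * R r) := fun r hr => by
    have h1 : 0 < √(deriv R r ^ 2 + deriv Z r ^ 2) * (σ * R r) :=
      mul_pos (Real.sqrt_pos.2 (hApos r hr)) (hσpos r hr)
    rcases hε2 with ⟨h, h2⟩ | ⟨h, h2⟩
    · refine Or.inl ⟨h, ?_⟩
      simp only [hw, h2]; linarith
    · refine Or.inr ⟨h, ?_⟩
      simp only [hw, h2]; linarith
  have dw : ∀ r ∈ I, HasDerivAt w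
      ((deriv R r * deriv (deriv R) r + deriv Z r * deriv (deriv Z) r) / w r) r := fun r hr => by
    have h1 := ((((dR₁ r hr).pow 2).add ((dZ₁ r hr).pow 2)).sqrt (hApos r hr).ne').const_mul ε
    refine h1.congr_deriv ?_
    have h2 : √(deriv R r ^ 2 + deriv Z r ^ 2) ≠ 0 := (Real.sqrt_pos.2 (hApos r hr)).ne'
    have h3 : ε ≠ 0 := by rintro rfl; norm_num at hε
    simp only [hw, Pi.add_apply, Pi.pow_apply]
    field_simp
    rw [hε]
    push_cast
    ring
  have hev : ∀ᶠ t in 𝓝 r, t ∈ I := hI.mem_nhds hr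
  have key := profile_horizontal (r₀ := r) (c := fun r => deriv R r / w r) (s := fun r => deriv Z r / w r)
    (z := fun r => 2 * Z r / R r) (l := fun r => w r / R r)
    (K := fun r => (deriv R r * deriv (deriv Z) r - deriv Z r * deriv (deriv R) r) * R r / w r ^ 3)
    ?_ ?_ ?_ ?_ ?_ ?_ ?_
  · exact (div_eq_zero_iff.1 key).resolve_right (hw0 r hr)
  · filter_upwards [hev] with t ht
    have := hw0 t ht
    rw [div_pow, div_pow, ← add_div, hw2 t ht, div_self (hApos t ht).ne']
  · filter_upwards [hev] with t ht using div_ne_zero (hw0 t ht) (hR0 t ht)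
  · filter_upwards [hev] with t ht
    have h1 := hw0 t ht
    have h2 := hR0 t ht
    refine ((dR₁ t ht).div (dw t ht) h1).congr_deriv ?_
    field_simp
    rw [hw2 t ht]
    ring
  · filter_upwards [hev] with t ht
    have h1 := hw0 t ht
    have h2 := hR0 t ht
    refine ((dZ₁ t ht).div (dw t ht) h1).congr_deriv ?_
    field_simp
    rw [hw2 t ht]
    ring
  · filter_upwards [hev] with t ht
    have h1 := hw0 t ht
    have h2 := hR0 t ht
    refine (((dZ t ht).const_mul 2).div (dR t ht) h2).congr_deriv ?_
    field_simp
    ring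
  · filter_upwards [hev] with t ht
    exact (curvature_equations hI dR dR₁ dZ dZ₁ hR hZ ha hb hc o hasd hs hg ht (hw2 t ht) (ho t ht)
      rfl rfl rfl rfl).1
  · filter_upwards [hev] with t ht
    exact (curvature_equations hI dR dR₁ dZ dZ₁ hR hZ ha hb hc o hasd hs hg ht (hw2 t ht) (ho t ht)
      rfl rfl rfl rfl).2

end BianchiIX

/-! ### Criteria for flatness and for isometry. -/

namespace ChartGeometry

section

variable {E : Type*} [NormedAddCommGroup E] [InnerProductSpace ℝ E] [FiniteDimensional ℝ E]

/-- A metric that is locally the pull-back of the flat metric of a space of the same dimension is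
flat. -/
theorem riemann_eq_zero_of_pullback {n : Type*} [Fintype n] [DecidableEq n]
    (e : Module.Basis n ℝ E) {φ : E → E} {g : MetricField E} {x : E} (hφ : ContDiffAt ℝ 3 φ x)
    (hg : ∀ᶠ y in 𝓝 x, g y = pullback φ (flatMetric E) y) (hdef : ∀ v, g x v v = 0 → v = 0)
    (u v w z : E) : riemann e g x u v w z = 0 := by
  have hinj : Function.Injective (fderiv ℝ φ x) := by
    rw [injective_iff_map_eq_zero]
    intro v hv
    apply hdef
    rw [hg.self_of_nhds, pullback_flatMetric_apply, hv, inner_zero_left]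
  have hsurj : Function.Surjective (fderiv ℝ φ x) :=
    LinearMap.surjective_of_injective (f := (fderiv ℝ φ x : E →ₗ[ℝ] E)) hinj
  rw [riemann_eq_of_pullback e hφ hg (gram_det_ne_zero e g x hdef) (fun _ _ => 0)
    (fun v w => (hsurj (fderiv ℝ (fderiv ℝ φ) x v w)).imp fun d hd => by rw [hd, add_zero])
    (fun _ _ _ => inner_zero_left _)]
  simp

/-- Definiteness of the pulled-back metric makes the differential injective, hence invertible; the
inverse function theorem gives openness and a smooth inverse. -/
theorem areIsometric_of_injOn {Φ : E → E} {M : Set E} {g h : MetricField E} (hM : IsOpen M)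
    (hΦ : ContDiffOn ℝ ∞ Φ M) (hinj : Set.InjOn Φ M) (hpull : ∀ x ∈ M, pullback Φ h x = g x)
    (hdef : ∀ x ∈ M, ∀ v, g x v v = 0 → v = 0) : AreIsometric M g (Φ '' M) h := by
  have hcd : ∀ x ∈ M, ContDiffAt ℝ ∞ Φ x := fun x hx => hΦ.contDiffAt (hM.mem_nhds hx)
  have hequiv : ∀ x ∈ M, ∃ L : E ≃L[ℝ] E, HasStrictFDerivAt Φ (L : E →L[ℝ] E) x := by
    intro x hx
    have hinj' : Function.Injective (fderiv ℝ Φ x : E →ₗ[ℝ] E) := by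
      rw [injective_iff_map_eq_zero]
      intro v hv
      apply hdef x hx
      rw [← hpull x hx, pullback, LinearMap.compl₁₂_apply, hv, map_zero]
    refine ⟨(LinearEquiv.ofInjectiveEndo _ hinj').toContinuousLinearEquiv, ?_⟩
    refine ((hcd x hx).hasStrictFDerivAt (by norm_num)).congr_fderiv ?_
    ext v; rfl
  have hopen : IsOpenMap (M.domRestrict Φ) := by
    rw [isOpenMap_iff_nhds_le]
    rintro ⟨x, hx⟩
    obtain ⟨L, hL⟩ := hequiv x hx
    rw [Set.domRestrict_eq, ← Filter.map_map, map_nhds_subtype_coe_eq_nhds hx (hM.mem_nhds hx)]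
    exact hL.map_nhds_eq_of_equiv.ge
  let Ψ : OpenPartialHomeomorph E E := OpenPartialHomeomorph.ofContinuousOpenRestrict
    (hinj.toPartialEquiv Φ M) hΦ.continuousOn hopen hM
  refine ⟨Ψ, rfl, rfl, hΦ, ?_, hpull⟩
  intro y hy
  have hx : Ψ.symm y ∈ M := Ψ.map_target hy
  obtain ⟨L, hL⟩ := hequiv _ hx
  exact (Ψ.contDiffAt_symm hy hL.hasFDerivAt (hcd _ hx)).contDiffWithinAt

end

end ChartGeometry

/-! ### The flat case `Z = 0`, and rescalings onto the Burns metric. -/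

namespace BianchiIX

variable {I : Set ℝ} {a b c R Z : ℝ → ℝ}

theorem inner_quatEmb (x y : ℍ[ℝ]) : inner ℝ (quatEmb x) (quatEmb y) = inner ℝ x y := by
  rw [quaternion_inner_eq, quatEmb_apply, quatEmb_apply]
  simp only [PiLp.inner_apply, Fin.sum_univ_succ]
  simp
  ring

/-- The map `(r, q) ↦ (log (f r), q)` of `ℝ × SU(2)`. -/
noncomputable def radialScaling (f : ℝ → ℝ) (x : ℍ[ℝ]) : ℍ[ℝ] :=
  (f (rCoord x) * Real.exp (-rCoord x)) • x

theorem contDiffOn_radialScaling {f : ℝ → ℝ} (hI : IsOpen I) (hf : ContDiffOn ℝ ∞ f I) :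
    ContDiffOn ℝ ∞ (radialScaling f) (region I) := by
  intro x hx
  have hr : ContDiffAt ℝ ∞ rCoord x := (contDiffAt_norm ℝ hx.1).log (norm_ne_zero_iff.2 hx.1)
  have hf' : ContDiffAt ℝ ∞ (fun y => f (rCoord y)) x :=
    ContDiffAt.comp x (hf.contDiffAt (hI.mem_nhds hx.2)) hr
  exact ((hf'.mul hr.neg.exp).smul contDiffAt_id).contDiffWithinAt

/-- With `Z = 0` the embedding factors as `radialScaling R` followed by the linear isometry
`quatEmb`, so the metric is pulled back from flat `ℝ⁴`. -/
theorem isFlatOn_of_eq_zero (hI : IsOpen I) (ha : ∀ r ∈ I, 0 < a r) (hb : ∀ r ∈ I, 0 < b r)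
    (hc : ∀ r ∈ I, 0 < c r) (hR : ContDiffOn ℝ ∞ R I) (hZ : ∀ r ∈ I, Z r = 0)
    (hg : ∀ x ∈ region I, pullback (radialMap R Z) (flatMetric (EuclideanSpace ℝ (Fin 7))) x
      = lrsMetric a b c x) : IsFlatOn stdBasis (lrsMetric a b c) (region I) := by
  intro x hx u v w z
  have hφ := contDiffOn_radialScaling hI hR
  have hopen := isOpen_region hI
  refine riemann_eq_zero_of_pullback (φ := radialScaling R) stdBasis
    ((hφ.contDiffAt (hopen.mem_nhds hx)).of_le (by norm_cast)) ?_
    (fun v => lrsMetric_definite hx.1 (ha _ hx.2) (hb _ hx.2) (hc _ hx.2)) u v w z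
  filter_upwards [hopen.mem_nhds hx] with y hy
  have hd : HasFDerivAt (radialMap R Z) (quatEmb.comp (fderiv ℝ (radialScaling R) y)) y := by
    have h1 := ((hφ.contDiffAt (hopen.mem_nhds hy)).differentiableAt (by norm_num)).hasFDerivAt
    refine (quatEmb.hasFDerivAt.comp y h1).congr_of_eventuallyEq ?_
    filter_upwards [hopen.mem_nhds hy] with t ht
    rw [radialMap_eq R Z ht.1, hZ _ ht.2, Function.comp, radialScaling, map_smul]
    simp
  rw [← hg y hy]
  refine LinearMap.ext fun u => LinearMap.ext fun v => ?_
  rw [pullback_flatMetric_apply, pullback_flatMetric_apply, hd.fderiv]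
  exact inner_quatEmb _ _

theorem norm_radialScaling {f : ℝ → ℝ} {x : ℍ[ℝ]} (hx : x ≠ 0) (hf : 0 < f (rCoord x)) :
    ‖radialScaling f x‖ = f (rCoord x) := by
  rw [radialScaling, norm_smul, Real.norm_of_nonneg (by positivity), ← exp_rCoord hx, mul_assoc,
    ← Real.exp_add, neg_add_cancel, Real.exp_zero, mul_one]

theorem injOn_radialScaling {f : ℝ → ℝ} (hf : ∀ r ∈ I, 0 < f r) (hinj : Set.InjOn f I) :
    Set.InjOn (radialScaling f) (region I) := by
  intro x hx y hy hxy
  have h1 := congrArg norm hxy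
  rw [norm_radialScaling hx.1 (hf _ hx.2), norm_radialScaling hy.1 (hf _ hy.2)] at h1
  have h2 := hinj hx.2 hy.2 h1
  rw [radialScaling, radialScaling, h2] at hxy
  have h3 := hf _ hy.2
  exact smul_right_injective _ (by positivity) hxy

theorem image_radialScaling {f : ℝ → ℝ} (hf : ∀ r ∈ I, 0 < f r) :
    radialScaling f '' region I = {y : ℍ[ℝ] | ‖y‖ ∈ f '' I} := by
  ext y
  constructor
  · rintro ⟨x, hx, rfl⟩
    exact ⟨_, hx.2, (norm_radialScaling hx.1 (hf _ hx.2)).symm⟩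
  · rintro ⟨r, hr, hy⟩
    have hfr := hf r hr
    have hy0 : ‖y‖ ≠ 0 := by rw [← hy]; exact hfr.ne'
    have hn : ‖(Real.exp r / f r) • y‖ = Real.exp r := by
      rw [norm_smul, Real.norm_of_nonneg (by positivity), ← hy, div_mul_cancel₀ _ hfr.ne']
    have hr' : rCoord ((Real.exp r / f r) • y) = r := by rw [rCoord, hn, Real.log_exp]
    refine ⟨(Real.exp r / f r) • y, ⟨?_, by rwa [hr']⟩, ?_⟩
    · rw [← norm_ne_zero_iff, hn]; exact Real.exp_ne_zero r
    · rw [radialScaling, hr', smul_smul]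
      have : f r * Real.exp (-r) * (Real.exp r / f r) = 1 := by
        rw [Real.exp_neg]; field_simp
      rw [this, one_smul]

/-- A radial rescaling changes `x⁻¹ dx` only in its real part, so every `σᵢ` is preserved, while `ρ`
pulls back to `f (r)`. -/
theorem pullback_burnsMetric {f : ℝ → ℝ} {f' k : ℝ} {x : ℍ[ℝ]} (hx : x ≠ 0)
    (hf : HasDerivAt f f' (rCoord x)) (hpos : 0 < f (rCoord x))
    (ha : a (rCoord x) = k * f' ^ 2) (hb : b (rCoord x) = k * (f (rCoord x) ^ 2 / 4 + 1 / 4))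
    (hc : c (rCoord x) = k * (f (rCoord x) ^ 2 / 4)) :
    pullback (radialScaling f) (k • burnsMetric) x = lrsMetric a b c x := by
  obtain ⟨D, hD⟩ : ∃ D : ℍ[ℝ] →L[ℝ] ℝ,
      HasFDerivAt (fun y => f (rCoord y) * Real.exp (-rCoord y)) D x :=
    ⟨_, hasFDerivAt_radial (p := fun r => f r * Real.exp (-r)) hx
      (hf.mul ((hasDerivAt_neg _).exp))⟩
  obtain ⟨s, hs⟩ : ∃ s, s = f (rCoord x) * Real.exp (-rCoord x) := ⟨_, rfl⟩
  have hs0 : s ≠ 0 := by rw [hs]; positivity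
  have hΦ : radialScaling f x = s • x := by rw [hs]; rfl
  have hΦ0 : radialScaling f x ≠ 0 := by rw [hΦ]; exact smul_ne_zero hs0 hx
  have hd : HasFDerivAt (radialScaling f) (s • ContinuousLinearMap.id ℝ ℍ[ℝ] + D.smulRight x) x := by
    rw [hs]; exact hD.smul (hasFDerivAt_id x)
  have hfd : ∀ v, fderiv ℝ (radialScaling f) x v = s • v + D v • x := fun v => by
    rw [hd.fderiv]; simp
  have hinv : ∀ v, (radialScaling f x)⁻¹ * fderiv ℝ (radialScaling f) x v
      = x⁻¹ * v + ((s⁻¹ * D v : ℝ) : ℍ[ℝ]) := fun v => by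
    rw [hfd, hΦ, ← Quaternion.coe_mul_eq_smul, mul_inv_rev, ← Quaternion.coe_inv, mul_add,
      ← Quaternion.coe_mul_eq_smul, ← Quaternion.coe_mul_eq_smul]
    have h1 : x⁻¹ * ((s⁻¹ : ℝ) : ℍ[ℝ]) = ((s⁻¹ : ℝ) : ℍ[ℝ]) * x⁻¹ :=
      (Quaternion.coe_commutes _ _).symm
    have h2 : x⁻¹ * ((D v : ℝ) : ℍ[ℝ]) = ((D v : ℝ) : ℍ[ℝ]) * x⁻¹ :=
      (Quaternion.coe_commutes _ _).symm
    congr 1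
    · rw [h1, mul_assoc, ← mul_assoc x⁻¹, (Quaternion.coe_commutes s x⁻¹).symm, mul_assoc,
        ← mul_assoc, ← Quaternion.coe_mul, inv_mul_cancel₀ hs0, Quaternion.coe_one, one_mul]
    · rw [h1, mul_assoc, ← mul_assoc x⁻¹, h2, mul_assoc, inv_mul_cancel₀ hx, mul_one,
        ← Quaternion.coe_mul]
  have h1 : ∀ v, sigma₁ (radialScaling f x) (fderiv ℝ (radialScaling f) x v) = sigma₁ x v :=
    fun v => by
      change 2 * ((radialScaling f x)⁻¹ * fderiv ℝ (radialScaling f) x v).imI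
        = 2 * (x⁻¹ * v).imI
      rw [hinv, Quaternion.imI_add, Quaternion.imI_coe, add_zero]
  have h2 : ∀ v, sigma₂ (radialScaling f x) (fderiv ℝ (radialScaling f) x v) = sigma₂ x v :=
    fun v => by
      change 2 * ((radialScaling f x)⁻¹ * fderiv ℝ (radialScaling f) x v).imJ
        = 2 * (x⁻¹ * v).imJ
      rw [hinv, Quaternion.imJ_add, Quaternion.imJ_coe, add_zero]
  have h3 : ∀ v, sigma₃ (radialScaling f x) (fderiv ℝ (radialScaling f) x v) = sigma₃ x v :=
    fun v => by
      change 2 * ((radialScaling f x)⁻¹ * fderiv ℝ (radialScaling f) x v).imK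
        = 2 * (x⁻¹ * v).imK
      rw [hinv, Quaternion.imK_add, Quaternion.imK_coe, add_zero]
  have hn : ‖radialScaling f x‖ = f (rCoord x) := norm_radialScaling hx hpos
  have h0 : ∀ v, dform (fun y => ‖y‖) (radialScaling f x) (fderiv ℝ (radialScaling f) x v)
      = f' * dform rCoord x v := fun v => by
    have hnd : DifferentiableAt ℝ (fun y : ℍ[ℝ] => ‖y‖) (radialScaling f x) :=
      (contDiffAt_norm (n := 1) ℝ hΦ0).differentiableAt (by norm_num)
    have e1 := hnd.hasFDerivAt.comp x hd
    have e2 := hf.comp_hasFDerivAt x (hasFDerivAt_rCoord hx)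
    have e3 := e1.unique (e2.congr_of_eventuallyEq (by
      have hc : ContinuousAt (fun y => f (rCoord y)) x :=
        hf.continuousAt.comp (hasFDerivAt_rCoord hx).continuousAt
      filter_upwards [isOpen_ne.mem_nhds hx, hc.eventually (lt_mem_nhds hpos)] with y hy hy'
      exact norm_radialScaling hy hy'))
    have e4 := congrArg (fun T : ℍ[ℝ] →L[ℝ] ℝ => T v) e3
    rw [← hd.fderiv] at e4
    rw [dform_rCoord hx]
    exact e4
  refine LinearMap.ext fun u => LinearMap.ext fun v => ?_
  rw [lrsMetric_apply, ha, hb, hc]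
  change k * (dform (fun y => ‖y‖) (radialScaling f x) (fderiv ℝ (radialScaling f) x u)
      * dform (fun y => ‖y‖) (radialScaling f x) (fderiv ℝ (radialScaling f) x v)
    + ‖radialScaling f x‖ ^ 2 / 4
      * (sigma₁ (radialScaling f x) (fderiv ℝ (radialScaling f) x u)
          * sigma₁ (radialScaling f x) (fderiv ℝ (radialScaling f) x v)
        + sigma₂ (radialScaling f x) (fderiv ℝ (radialScaling f) x u)
          * sigma₂ (radialScaling f x) (fderiv ℝ (radialScaling f) x v)
        + sigma₃ (radialScaling f x) (fderiv ℝ (radialScaling f) x u)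
          * sigma₃ (radialScaling f x) (fderiv ℝ (radialScaling f) x v))
    + 1 / 4 * (sigma₁ (radialScaling f x) (fderiv ℝ (radialScaling f) x u)
          * sigma₁ (radialScaling f x) (fderiv ℝ (radialScaling f) x v)
        + sigma₂ (radialScaling f x) (fderiv ℝ (radialScaling f) x u)
          * sigma₂ (radialScaling f x) (fderiv ℝ (radialScaling f) x v))) = _
  rw [h0, h0, h1, h1, h2, h2, h3, h3, hn]
  ring

theorem injOn_of_deriv_ne_zero {f : ℝ → ℝ} (hI : I.OrdConnected) (hf : ContinuousOn f I)
    (hf' : ∀ r ∈ I, deriv f r ≠ 0) : Set.InjOn f I := by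
  have key : ∀ x ∈ I, ∀ y ∈ I, x < y → f x ≠ f y := by
    intro x hx y hy hxy h
    obtain ⟨t, ht, ht0⟩ := exists_deriv_eq_zero hxy (hf.mono (hI.out hx hy)) h
    exact hf' t (hI.out hx hy (Set.Ioo_subset_Icc_self ht)) ht0
  intro x hx y hy h
  rcases lt_trichotomy x y with h1 | h1 | h1
  · exact absurd h (key x hx y hy h1)
  · exact h1
  · exact absurd h.symm (key y hy x hx h1)

end BianchiIX

/-! ### Conclusion: identification with the Burns metric. -/

theorem theorem5p1
    (I : Set ℝ) (hI_open : IsOpen I) (hI_conn : I.OrdConnected)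
    (a b c : ℝ → ℝ)
    (ha : ContDiffOn ℝ ∞ a I) (hb : ContDiffOn ℝ ∞ b I) (hc : ContDiffOn ℝ ∞ c I)
    (ha_pos : ∀ r ∈ I, 0 < a r) (hb_pos : ∀ r ∈ I, 0 < b r) (hc_pos : ∀ r ∈ I, 0 < c r)
    (h_nonflat : ¬ ChartGeometry.IsFlatOn BianchiIX.stdBasis
      (BianchiIX.lrsMetric a b c) (BianchiIX.region I))
    (o : Orientation ℝ ℍ[ℝ] (Fin 4))
    (h_asd : ChartGeometry.IsAntiSelfDualOn BianchiIX.stdBasis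
      (BianchiIX.lrsMetric a b c) o (BianchiIX.region I))
    (h_scalar : ChartGeometry.IsScalarFlatOn BianchiIX.stdBasis
      (BianchiIX.lrsMetric a b c) (BianchiIX.region I))
    (R Z : ℝ → ℝ) (hR : ContDiffOn ℝ ∞ R I) (hZ : ContDiffOn ℝ ∞ Z I)
    (h_isometric : ∀ x ∈ BianchiIX.region I,
      ChartGeometry.pullback (BianchiIX.radialMap R Z)
        (ChartGeometry.flatMetric (EuclideanSpace ℝ (Fin 7))) x
      = BianchiIX.lrsMetric a b c x) :
    ∃ k : ℝ, 0 < k ∧ ∃ J : Set ℝ, IsOpen J ∧ J.OrdConnected ∧ J ⊆ Set.Ioi 0 ∧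
      ChartGeometry.AreIsometric
        (BianchiIX.region I) (BianchiIX.lrsMetric a b c)
        {y : ℍ[ℝ] | ‖y‖ ∈ J} (k • BianchiIX.burnsMetric) := by
  have hpre : IsPreconnected I := hI_conn.isPreconnected
  have dR := fun r (hr : r ∈ I) => BianchiIX.hasDerivAt_of_contDiffOn hI_open hR hr
  have dZ := fun r (hr : r ∈ I) => BianchiIX.hasDerivAt_of_contDiffOn hI_open hZ hr
  have hcoef := fun r (hr : r ∈ I) => BianchiIX.coefficients_of_isometric (dR r hr) (dZ r hr)
    (h_isometric _ (BianchiIX.coe_exp_mem_region hr))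
  have hZ' : ∀ r ∈ I, deriv Z r = 0 := fun r hr =>
    BianchiIX.deriv_eq_zero_of_antiSelfDual hI_open hpre ha_pos hb_pos hc_pos o h_asd h_scalar hR hZ
      h_isometric hr
  have hR0 : ∀ r ∈ I, R r ≠ 0 := fun r hr h0 => by
    have := hc_pos r hr
    rw [(hcoef r hr).2.2, h0] at this
    norm_num at this
  have hR' : ∀ r ∈ I, deriv R r ≠ 0 := fun r hr h0 => by
    have := ha_pos r hr
    rw [(hcoef r hr).1, h0, hZ' r hr] at this
    norm_num at this
  obtain ⟨Z₀, hZ₀⟩ := hI_open.exists_is_const_of_deriv_eq_zero hpre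
    (hZ.differentiableOn (by norm_num)) hZ'
  have hZ₀ne : Z₀ ≠ 0 := fun h0 => h_nonflat
    (BianchiIX.isFlatOn_of_eq_zero hI_open ha_pos hb_pos hc_pos hR
      (fun r hr => (hZ₀ r hr).trans h0) h_isometric)
  obtain ⟨σ, hσ, hσpos⟩ := BianchiIX.exists_sign_of_ne_zero hpre hR.continuousOn hR0
  have hσ2 : σ ^ 2 = 1 := by rcases hσ with h | h <;> rw [h] <;> norm_num
  have hσ0 : σ ≠ 0 := by rintro rfl; norm_num at hσ2
  have hZabs : 0 < |Z₀| := abs_pos.2 hZ₀ne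
  -- The scale is forced: `k / 4 = Z₀²` gives `k = 4 Z₀²`, and `k f² = R²` then gives `f = |R| /
  -- (2|Z₀|)`.
  obtain ⟨f, hf⟩ : ∃ f : ℝ → ℝ, f = fun r => σ / (2 * |Z₀|) * R r := ⟨_, rfl⟩
  have hfd : ∀ r ∈ I, HasDerivAt f (σ / (2 * |Z₀|) * deriv R r) r := fun r hr => by
    rw [hf]; exact (dR r hr).const_mul _
  have hfc : ContDiffOn ℝ ∞ f I := by rw [hf]; exact contDiffOn_const.mul hR
  have hf' : ∀ r ∈ I, deriv f r ≠ 0 := fun r hr => by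
    rw [(hfd r hr).deriv]
    exact mul_ne_zero (by positivity) (hR' r hr)
  have hfpos : ∀ r ∈ I, 0 < f r := fun r hr => by
    rw [hf]
    have := hσpos r hr
    have h2 : σ / (2 * |Z₀|) * R r = σ * R r / (2 * |Z₀|) := by ring
    simp only [h2]; positivity
  refine ⟨4 * Z₀ ^ 2, by positivity, f '' I, ?_, ?_, ?_, ?_⟩
  · rw [isOpen_iff_mem_nhds]
    rintro _ ⟨r, hr, rfl⟩
    have hs : HasStrictDerivAt f (deriv f r) r :=
      (hfc.contDiffAt (hI_open.mem_nhds hr)).hasStrictDerivAt (by norm_num)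
    rw [← hs.map_nhds_eq (hf' r hr)]
    exact Filter.image_mem_map (hI_open.mem_nhds hr)
  · exact (hpre.image f hfc.continuousOn).ordConnected
  · rintro _ ⟨r, hr, rfl⟩
    exact hfpos r hr
  · rw [← BianchiIX.image_radialScaling hfpos]
    refine ChartGeometry.areIsometric_of_injOn (BianchiIX.isOpen_region hI_open)
      (BianchiIX.contDiffOn_radialScaling hI_open hfc)
      (BianchiIX.injOn_radialScaling hfpos
        (BianchiIX.injOn_of_deriv_ne_zero hI_conn hfc.continuousOn hf')) ?_
      (fun x hx v => BianchiIX.lrsMetric_definite hx.1 (ha_pos _ hx.2) (hb_pos _ hx.2)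
        (hc_pos _ hx.2))
    intro x hx
    have habs : |Z₀| ^ 2 = Z₀ ^ 2 := sq_abs Z₀
    refine BianchiIX.pullback_burnsMetric hx.1 (hfd _ hx.2) (hfpos _ hx.2) ?_ ?_ ?_
    · rw [(hcoef _ hx.2).1, hZ' _ hx.2, mul_pow, div_pow, mul_pow, habs, hσ2]
      field_simp; ring
    · rw [(hcoef _ hx.2).2.1, hZ₀ _ hx.2, hf]
      simp only [mul_pow, div_pow, habs, hσ2]
      field_simp
      ring
    · rw [(hcoef _ hx.2).2.2, hf]
      simp only [mul_pow, div_pow, habs, hσ2]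
      field_simp
      ring
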